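/- Let $a<b$ and $T>0$. For $\varepsilon\in(0,1]$ consider the one-dimensional sine–Gordon equation $$w_{tt}-w_{xx}+\varepsilon^{-1}\sin(\varepsilon w)=0,\qquad x\in(a,b),\ 0\le t\le T/\varepsilon^2,$$ for real-valued $w$, with $(b-a)$-periodic boundary conditions and initial data $w(\cdot,0)=\phi$, $\partial_t w(\cdot,0)=\gamma$, understood in the weak sense. For $u(x)=\sum_{l\in\mathbb Z}\widehat u_l e^{i\mu_l(x-a)}$ with $\mu_l=2\pi l/(b-a)$, put $\|u\|_{H^s}^2=\sum_l(1+\mu_l^2)^s|\widehat u_l|^2$ and $\|u\|_{L^2}=\|u\|_{H^0}$, and let $\langle\nabla\rangle$, $\langle\nabla\rangle^{-1}$ and $e^{i\tau\langle\nabla\rangle}$ be the Fourier multipliers with symbols $\delta_l=\sqrt{1+\mu_l^2}$, $\delta_l^{-1}$ and $e^{i\tau\delta_l}$. With $f(u)=\varepsilon^{-1}\sin(\varepsilon u)-u$ and $F(\psi)=i\langle\nabla\rangle^{-1}f\big(\tfrac12(\psi+\overline\psi)\big)$, the first-order Lawson-type exponential integrator with time step $\tau>0$ is $$\psi^{[0]}=\phi-i\langle\nabla\rangle^{-1}\gamma,\qquad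 \psi^{[n+1]}=e^{i\tau\langle\nabla\rangle}\psi^{[n]}+\tau e^{i\tau\langle\nabla\rangle}F(\psi^{[n]}),$$ $$w^{[n]}=\tfrac12\big(\psi^{[n]}+\overline{\psi^{[n]}}\big),\qquad z^{[n]}=\tfrac i2\langle\nabla\rangle\big(\psi^{[n]}-\overline{\psi^{[n]}}\big).$$ Write $t_n=n\tau$ and $\mathcal E_n=\|w(\cdot,t_n)-w^{[n]}\|_{H^1}+\|\partial_t w(\cdot,t_n)-z^{[n]}\|_{L^2}$. For an integer $m\ge0$ and $K\in\mathbb R$, let (A$_{m,K}$) be the assumption $$\|w\|_{L^\infty([0,T/\varepsilon^2];H^{m+1})}\le K,\qquad \|\partial_t w\|_{L^\infty([0,T/\varepsilon^2];H^m)}\le K.$$ **(1)** For all $m\ge0$, $K$ and $\beta>0$ there are $\tau_{\max}\in(0,1]$ and $C>0$, depending only on $a,b,T,m,K,\beta$, such that for all $0<\tau_0\le\tau_{\max}$, all $\varepsilon\in(0,1]$, all $0<\tau<\beta\tau_0$ and every solution $w$ satisfying (A$_{m,K}$), $$\mathcal E_n\le C\big(\varepsilon^2\tau+\tau_0^{m+1}\big)\qquad\text{for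 all integers } 0\le n\le \frac{T/\varepsilon^2}{\tau}.$$ **(2)** (Smooth solutions.) For every sequence $(K_m)_{m\ge0}$ and every integer $N\ge0$ there are $\tau_{\max}>0$ and $C>0$, depending only on $a,b,T,(K_m)_m,N$, such that for all $\varepsilon\in(0,1]$, all $0<\tau<\tau_{\max}$, every solution $w$ satisfying (A$_{m,K_m}$) for all $m\ge0$, and all integers $0\le n\le \frac{T/\varepsilon^2}{\tau}$, $$\mathcal E_n\le C\big(\varepsilon^2\tau+\tau^{N+1}\big),$$ and moreover $\mathcal E_n\le C\,\varepsilon^2\tau$ whenever $\tau^N\le\varepsilon^2$. -/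

import Mathlib

open MeasureTheory AddCircle
open scoped ENNReal

noncomputable section

namespace SineGordon

/-- Real-valued square-integrable functions on the circle `ℝ / Lℤ`, that is, `L`-periodic functions
(the interval `(a, b)` with periodic boundary conditions is the case `L = b - a`). -/
abbrev RealL2 (L : ℝ) [Fact (0 < L)] : Type := Lp ℝ 2 (haarAddCircle (T := L))

/-- Complex-valued square-integrable functions on the circle `ℝ / Lℤ`. -/
abbrev ComplexL2 (L : ℝ) [Fact (0 < L)] : Type := Lp ℂ 2 (haarAddCircle (T := L))

/-- A real-valued function regarded as a complex-valued one. -/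
def toComplex {L : ℝ} [Fact (0 < L)] (u : RealL2 L) : ComplexL2 L :=
  Complex.ofRealCLM.compLp u

/-- The real part `(ψ + conj ψ) / 2`. -/
def realPart {L : ℝ} [Fact (0 < L)] (ψ : ComplexL2 L) : RealL2 L :=
  Complex.reCLM.compLp ψ

/-- The frequency `μ_l = 2 π l / L`. -/
def freq (L : ℝ) (l : ℤ) : ℝ := 2 * Real.pi * l / L

/-- The periodic Sobolev norm `(∑_l (1 + μ_l²)^s |û_l|²)^{1/2}`, with the value `∞` outside `H^s`.
For `s = 0` this is the `L²` norm (with respect to the normalized measure `dx / L`). -/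
def sobolevNorm {L : ℝ} [Fact (0 < L)] (s : ℕ) (u : ComplexL2 L) : ℝ≥0∞ :=
  (∑' l : ℤ, ENNReal.ofReal ((1 + freq L l ^ 2) ^ s * ‖fourierCoeff u l‖ ^ 2)) ^ (1 / 2 : ℝ)

open Classical in
/-- The Fourier multiplier with symbol `σ`: the function with Fourier coefficients `σ l * û_l`.
Its natural domain consists of those `u` for which these coefficients are square summable;
outside the domain the value is `0` by convention. -/
def fourierMultiplier {L : ℝ} [Fact (0 < L)] (σ : ℤ → ℂ) (u : ComplexL2 L) : ComplexL2 L :=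
  if h : Memℓp (fun l : ℤ => σ l * fourierCoeff u l) 2 then
    (fourierBasis (T := L)).repr.symm ⟨fun l : ℤ => σ l * fourierCoeff u l, h⟩
  else 0

/-- The symbol `√(1 + μ_l²)` of `⟨∇⟩ = √(1 - Δ)`. -/
def japaneseSymbol (L : ℝ) (l : ℤ) : ℝ := Real.sqrt (1 + freq L l ^ 2)

/-- The operator `⟨∇⟩`, with domain `H¹`. -/
def japanese {L : ℝ} [Fact (0 < L)] (u : ComplexL2 L) : ComplexL2 L :=
  fourierMultiplier (fun l => (japaneseSymbol L l : ℂ)) u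

/-- The operator `⟨∇⟩⁻¹`. -/
def japaneseInv {L : ℝ} [Fact (0 < L)] (u : ComplexL2 L) : ComplexL2 L :=
  fourierMultiplier (fun l => ((japaneseSymbol L l : ℂ))⁻¹) u

/-- The operator `exp (i τ ⟨∇⟩)`. -/
def propagator {L : ℝ} [Fact (0 < L)] (τ : ℝ) (u : ComplexL2 L) : ComplexL2 L :=
  fourierMultiplier (fun l => Complex.exp (Complex.I * τ * japaneseSymbol L l)) u

theorem lipschitzWith_sin_mul_div (ε : ℝ) :
    LipschitzWith 1 (fun x : ℝ => Real.sin (ε * x) / ε) := by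
  refine LipschitzWith.of_dist_le_mul fun x y => ?_
  rcases eq_or_ne ε 0 with rfl | hε
  · simp
  have h : |Real.sin (ε * x) - Real.sin (ε * y)| ≤ |ε * x - ε * y| := by
    simpa [Real.dist_eq] using Real.lipschitzWith_sin.dist_le_mul (ε * x) (ε * y)
  rw [Real.dist_eq, Real.dist_eq, ← sub_div, abs_div, div_le_iff₀ (abs_pos.mpr hε)]
  calc |Real.sin (ε * x) - Real.sin (ε * y)| ≤ |ε * x - ε * y| := h
    _ = (1 : NNReal) * |x - y| * |ε| := by rw [← mul_sub, abs_mul]; push_cast; ring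

/-- The pointwise composition `ε⁻¹ sin (ε u)`. -/
def scaledSine {L : ℝ} [Fact (0 < L)] (ε : ℝ) (u : RealL2 L) : RealL2 L :=
  (lipschitzWith_sin_mul_div ε).compLp (by simp) u

/-- The nonlinearity left after the linear part is split off: `f (u) = ε⁻¹ sin (ε u) - u`. -/
def splitTerm {L : ℝ} [Fact (0 < L)] (ε : ℝ) (u : RealL2 L) : RealL2 L :=
  scaledSine ε u - u

/-- `F (ψ) = i ⟨∇⟩⁻¹ f ((ψ + conj ψ) / 2)`. -/
def nlsTerm {L : ℝ} [Fact (0 < L)] (ε : ℝ) (ψ : ComplexL2 L) : ComplexL2 L :=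
  Complex.I • japaneseInv (toComplex (splitTerm ε (realPart ψ)))

/-- One step of the first-order Lawson-type exponential integrator with time step `τ`. -/
def lawsonStep {L : ℝ} [Fact (0 < L)] (ε τ : ℝ) (ψ : ComplexL2 L) : ComplexL2 L :=
  propagator τ ψ + (τ : ℂ) • propagator τ (nlsTerm ε ψ)

/-- The initial value `ψ₀ = φ - i ⟨∇⟩⁻¹ γ`. -/
def initialPsi {L : ℝ} [Fact (0 < L)] (φ γ : RealL2 L) : ComplexL2 L :=
  toComplex φ - Complex.I • japaneseInv (toComplex γ)

/-- The numerical approximation `ψ^[n]`. -/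
def lawsonPsi {L : ℝ} [Fact (0 < L)] (ε τ : ℝ) (φ γ : RealL2 L) : ℕ → ComplexL2 L
  | 0 => initialPsi φ γ
  | n + 1 => lawsonStep ε τ (lawsonPsi ε τ φ γ n)

/-- The numerical approximation `w^[n] = (ψ^[n] + conj ψ^[n]) / 2`. -/
def lawsonW {L : ℝ} [Fact (0 < L)] (ε τ : ℝ) (φ γ : RealL2 L) (n : ℕ) : ComplexL2 L :=
  (1 / 2 : ℂ) • (lawsonPsi ε τ φ γ n + star (lawsonPsi ε τ φ γ n))

/-- The numerical approximation `z^[n] = (i / 2) ⟨∇⟩ (ψ^[n] - conj ψ^[n])` of `∂ₜ w`. -/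
def lawsonZ {L : ℝ} [Fact (0 < L)] (ε τ : ℝ) (φ γ : RealL2 L) (n : ℕ) : ComplexL2 L :=
  (Complex.I / 2) • japanese (lawsonPsi ε τ φ γ n - star (lawsonPsi ε τ φ γ n))

/-- The derivative of a function on the circle. -/
def circleDeriv {L : ℝ} (χ : AddCircle L → ℂ) (x : AddCircle L) : ℂ :=
  deriv (fun h : ℝ => χ (x + (h : AddCircle L))) 0

/-- Smoothness of a function on the circle, that is, of the corresponding periodic function. -/
def IsSmooth {L : ℝ} (χ : AddCircle L → ℂ) : Prop :=
  ContDiff ℝ (⊤ : ℕ∞) (fun x : ℝ => χ (x : AddCircle L))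

/-- The pairing `∫ u χ` of a function in `L²` with a test function. -/
def pairing {L : ℝ} [Fact (0 < L)] (u : RealL2 L) (χ : AddCircle L → ℂ) : ℂ :=
  ∫ x : AddCircle L, (u x : ℂ) * χ x ∂haarAddCircle

/-- `w`, with time derivative `z`, is a weak solution on `[0, S]` of
`∂ₜₜ w - ∂ₓₓ w + ε⁻¹ sin (ε w) = 0` with periodic boundary conditions: for every smooth periodic
test function `χ` and every `t ∈ [0, S]`, `d/dt ∫ w χ = ∫ z χ` and
`d/dt ∫ z χ = ∫ w χ'' - ∫ ε⁻¹ sin (ε w) χ`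
(one-sided derivatives at the end points). The initial data are `w 0` and `z 0`. -/
structure IsSolution {L : ℝ} [Fact (0 < L)] (ε S : ℝ) (w z : ℝ → RealL2 L) : Prop where
  deriv_w : ∀ χ : AddCircle L → ℂ, IsSmooth χ → ∀ t ∈ Set.Icc 0 S,
    HasDerivWithinAt (fun s => pairing (w s) χ) (pairing (z t) χ) (Set.Icc 0 S) t
  deriv_z : ∀ χ : AddCircle L → ℂ, IsSmooth χ → ∀ t ∈ Set.Icc 0 S,
    HasDerivWithinAt (fun s => pairing (z s) χ)
      (pairing (w t) (circleDeriv (circleDeriv χ)) - pairing (scaledSine ε (w t)) χ)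
      (Set.Icc 0 S) t

/-- The regularity assumption: the norms of `w` in `L^∞([0, S]; H^{m+1})` and of `z = ∂ₜ w` in
`L^∞([0, S]; H^m)` are at most `K`. -/
def RegularityBound {L : ℝ} [Fact (0 < L)] (m : ℕ) (K S : ℝ) (w z : ℝ → RealL2 L) : Prop :=
  ∀ᵐ t ∂(volume.restrict (Set.Icc (0 : ℝ) S)),
    sobolevNorm (m + 1) (toComplex (w t)) ≤ ENNReal.ofReal K ∧
      sobolevNorm m (toComplex (z t)) ≤ ENNReal.ofReal K

/-- The error `‖w(tₙ) - w^[n]‖_{H¹} + ‖∂ₜ w(tₙ) - z^[n]‖_{L²}` at `tₙ = n τ`. -/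
def lawsonError {L : ℝ} [Fact (0 < L)] (ε τ : ℝ) (w z : ℝ → RealL2 L) (n : ℕ) : ℝ≥0∞ :=
  sobolevNorm 1 (toComplex (w (n * τ)) - lawsonW ε τ (w 0) (z 0) n) +
    sobolevNorm 0 (toComplex (z (n * τ)) - lawsonZ ε τ (w 0) (z 0) n)

end SineGordon

end

/-! Put `Ξ = ⟨∇⟩w - i ∂ₜw` and `X(t) = e^{-it⟨∇⟩} Ξ(t)`. The linear part disappears and `X' = drift
ε t X`, where the drift has size `ε²` and Lipschitz constant of order `ε²` on bounded sets, with
respect to the `L²` norm of `X`, that is, the energy norm of `(w, ∂ₜw)`. In these variables the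
Lawson integrator is exactly the explicit Euler method (`lawsonPsi_eq`).

A direct estimate of the Euler defect is `ε²τ²` per step, which adds up to `τ` over `T/(ε²τ)` steps.
The missing factor `ε²` comes from cancellation between steps. The defect has two sources. The
motion of `X` during a step, of size `ε²τ`, contributes only `ε⁴τ²`. The explicit time dependence of
the drift must be treated more finely. Write `ε⁻¹ sin (εu) - u = -ε²u³/6 + O(ε⁴)`. The quintic
remainder is already `ε⁴` and needs only Lipschitz continuity in time
(`IsTrajectory.norm_quintic_sub_le`). The cubic term is a sum over triples of modes, each carrying a
phase `e^{iθt}`, where `θ` is the resonance function.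

Truncate the cubic term to symbols below `D` with `6Dτ ≤ 1`, so that `|θτ| ≤ 1`. A triple
contributes `e^{iθt}(∫₀^τ e^{iθr} dr - τ)` to the defect at time `t`. This vanishes for `θ = 0`;
otherwise `θτ` stays away from the nonzero multiples of `2π`, and the contribution is a difference
of `e^{iθt} q` with `|q| ≤ 2τ` (`phaseQuotient_mul`, `norm_phaseQuotient_le`). Summation by parts
leaves boundary terms `ε²τ` and corrections `ε⁴τ²` from the slow change of `X`
(`IsTrajectory.norm_sum_localError_le`). The discarded modes cost `D^{-(m+1)}` after the long time,
by regularity of `w`; with `D` of order `1/τ₀` this is `τ₀^{m+1}`. A discrete Gronwall argument,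
with Lipschitz constant `ε²` over time `T/ε²`, turns the accumulated defect into the global error
(`IsTrajectory.norm_sub_scheme_le`). -/

noncomputable section

namespace SineGordon

/-! ### Elementary properties of the symbols. -/

section Symbols

variable {L : ℝ}

theorem one_le_japaneseSymbol (l : ℤ) : 1 ≤ japaneseSymbol L l := by
  rw [japaneseSymbol, Real.one_le_sqrt]
  nlinarith [sq_nonneg (freq L l)]

theorem japaneseSymbol_pos (l : ℤ) : 0 < japaneseSymbol L l :=
  lt_of_lt_of_le one_pos (one_le_japaneseSymbol l)

theorem japaneseSymbol_ne_zero (l : ℤ) : (japaneseSymbol L l : ℂ) ≠ 0 :=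
  Complex.ofReal_ne_zero.mpr (japaneseSymbol_pos l).ne'

theorem sq_japaneseSymbol (l : ℤ) : japaneseSymbol L l ^ 2 = 1 + freq L l ^ 2 :=
  Real.sq_sqrt (by positivity)

theorem freq_neg (l : ℤ) : freq L (-l) = -freq L l := by
  simp [freq, neg_div]

theorem japaneseSymbol_neg (l : ℤ) : japaneseSymbol L (-l) = japaneseSymbol L l := by
  simp [japaneseSymbol, freq_neg]

theorem norm_phase (x : ℝ) : ‖Complex.exp (Complex.I * x)‖ = 1 := by
  rw [mul_comm]; exact Complex.norm_exp_ofReal_mul_I x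

end Symbols

/-! ### Fourier coefficients, multipliers and Parseval estimates in `L²`. -/

section Fourier

variable {L : ℝ} [Fact (0 < L)]

/-- The `l`-th Fourier coefficient as a continuous linear functional. -/
def fc (l : ℤ) : ComplexL2 L →L[ℂ] ℂ := innerSL ℂ (fourierLp (T := L) 2 l)

theorem fourierCoeff_eq_fc (u : ComplexL2 L) (l : ℤ) : fourierCoeff u l = fc l u := by
  rw [← fourierBasis_repr, HilbertBasis.repr_apply_apply, coe_fourierBasis]
  rfl

theorem repr_eq_fc (u : ComplexL2 L) (l : ℤ) : fourierBasis.repr u l = fc l u := by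
  rw [fourierBasis_repr, fourierCoeff_eq_fc]

theorem fc_fourierLp (k l : ℤ) : fc (L := L) k (fourierLp 2 l) = if k = l then 1 else 0 := by
  have := orthonormal_iff_ite.mp (orthonormal_fourier (T := L)) k l
  simpa [fc] using this

theorem hasSum_fc (u : ComplexL2 L) : HasSum (fun l => fc l u • fourierLp (T := L) 2 l) u := by
  have := hasSum_fourier_series_L2 u
  simpa only [fourierCoeff_eq_fc] using this

theorem hasSum_sq_fc (u : ComplexL2 L) : HasSum (fun l => ‖fc l u‖ ^ 2) (‖u‖ ^ 2) := by
  have h := lp.hasSum_norm (p := 2) (by norm_num) (fourierBasis.repr u)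
  have h2 : ((2 : ℝ≥0∞).toReal) = ((2 : ℕ) : ℝ) := by norm_num
  rw [LinearIsometryEquiv.norm_map] at h
  simpa only [h2, Real.rpow_natCast, repr_eq_fc] using h

theorem summable_sq_fc (u : ComplexL2 L) : Summable (fun l => ‖fc l u‖ ^ 2) :=
  (hasSum_sq_fc u).summable

theorem sum_sq_fc_le (u : ComplexL2 L) (s : Finset ℤ) : ∑ l ∈ s, ‖fc l u‖ ^ 2 ≤ ‖u‖ ^ 2 :=
  sum_le_hasSum s (fun _ _ => by positivity) (hasSum_sq_fc u)

theorem fc_ext {u v : ComplexL2 L} (h : ∀ l, fc l u = fc l v) : u = v := by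
  have hu := hasSum_fc u
  simp only [h] at hu
  exact hu.unique (hasSum_fc v)

theorem norm_le_of_sum_sq_fc_le {u : ComplexL2 L} {B : ℝ} (hB : 0 ≤ B)
    (h : ∀ s : Finset ℤ, ∑ l ∈ s, ‖fc l u‖ ^ 2 ≤ B ^ 2) : ‖u‖ ≤ B :=
  le_of_sq_le_sq (hasSum_le_of_sum_le (hasSum_sq_fc u) h) hB

theorem norm_le_mul_of_norm_fc_le {u v : ComplexL2 L} {C : ℝ} (hC : 0 ≤ C)
    (h : ∀ l, ‖fc l u‖ ≤ C * ‖fc l v‖) : ‖u‖ ≤ C * ‖v‖ := by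
  refine norm_le_of_sum_sq_fc_le (by positivity) fun s => ?_
  calc ∑ l ∈ s, ‖fc l u‖ ^ 2 ≤ ∑ l ∈ s, C ^ 2 * ‖fc l v‖ ^ 2 := by
        gcongr with l _
        rw [← mul_pow]
        exact pow_le_pow_left₀ (norm_nonneg _) (h l) 2
    _ = C ^ 2 * ∑ l ∈ s, ‖fc l v‖ ^ 2 := by rw [Finset.mul_sum]
    _ ≤ C ^ 2 * ‖v‖ ^ 2 := by gcongr; exact sum_sq_fc_le v s
    _ = (C * ‖v‖) ^ 2 := by ring

/-- If `‖û_l‖ ≤ A ‖v̂_l‖ + ‖ŵ_l‖` for all `l`, then `‖u‖ ≤ A ‖v‖ + ‖w‖`. -/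
theorem norm_le_of_norm_fc_le_add {u v w : ComplexL2 L} {A : ℝ} (hA : 0 ≤ A)
    (h : ∀ l, ‖fc l u‖ ≤ A * ‖fc l v‖ + ‖fc l w‖) : ‖u‖ ≤ A * ‖v‖ + ‖w‖ := by
  refine norm_le_of_sum_sq_fc_le (by positivity) fun s => ?_
  have hv := sum_sq_fc_le v s
  have hw := sum_sq_fc_le w s
  have hcs : ∑ l ∈ s, ‖fc l v‖ * ‖fc l w‖ ≤ ‖v‖ * ‖w‖ := by
    refine le_of_sq_le_sq ?_ (by positivity)
    calc (∑ l ∈ s, ‖fc l v‖ * ‖fc l w‖) ^ 2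
        ≤ (∑ l ∈ s, ‖fc l v‖ ^ 2) * ∑ l ∈ s, ‖fc l w‖ ^ 2 :=
          Finset.sum_mul_sq_le_sq_mul_sq _ _ _
      _ ≤ ‖v‖ ^ 2 * ‖w‖ ^ 2 := by gcongr
      _ = (‖v‖ * ‖w‖) ^ 2 := by ring
  calc ∑ l ∈ s, ‖fc l u‖ ^ 2 ≤ ∑ l ∈ s, (A * ‖fc l v‖ + ‖fc l w‖) ^ 2 := by
        gcongr with l _
        exact h l
    _ = A ^ 2 * ∑ l ∈ s, ‖fc l v‖ ^ 2 + 2 * A * ∑ l ∈ s, ‖fc l v‖ * ‖fc l w‖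
          + ∑ l ∈ s, ‖fc l w‖ ^ 2 := by
        rw [Finset.mul_sum, Finset.mul_sum, ← Finset.sum_add_distrib, ← Finset.sum_add_distrib]
        exact Finset.sum_congr rfl fun l _ => by ring
    _ ≤ A ^ 2 * ‖v‖ ^ 2 + 2 * A * (‖v‖ * ‖w‖) + ‖w‖ ^ 2 := by gcongr
    _ = (A * ‖v‖ + ‖w‖) ^ 2 := by ring

theorem memℓp_of_sum_sq_le {c : ℤ → ℂ} {B : ℝ}
    (h : ∀ s : Finset ℤ, ∑ l ∈ s, ‖c l‖ ^ 2 ≤ B) : Memℓp c 2 := by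
  refine memℓp_gen (summable_of_sum_le (c := B) (fun _ => by positivity) fun s => ?_)
  have h2 : ((2 : ℝ≥0∞).toReal) = ((2 : ℕ) : ℝ) := by norm_num
  simpa only [h2, Real.rpow_natCast] using h s

theorem exists_fc_eq {c : ℤ → ℂ} {B : ℝ} (h : ∀ s : Finset ℤ, ∑ l ∈ s, ‖c l‖ ^ 2 ≤ B) :
    ∃ u : ComplexL2 L, ∀ l, fc l u = c l := by
  refine ⟨fourierBasis.repr.symm ⟨c, memℓp_of_sum_sq_le h⟩, fun l => ?_⟩
  rw [← repr_eq_fc, LinearIsometryEquiv.apply_symm_apply]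

/-- The function `v` witnesses that `u` lies in the domain, so the default value `0` is never taken.
This is how the unbounded operator `japanese` is evaluated later. -/
theorem fourierMultiplier_eq_of_fc {σ : ℤ → ℂ} {u v : ComplexL2 L} (h : ∀ l, fc l v = σ l * fc l u) :
    fourierMultiplier σ u = v := by
  have hm : Memℓp (fun l : ℤ => σ l * fourierCoeff u l) 2 := by
    refine memℓp_of_sum_sq_le (B := ‖v‖ ^ 2) fun s => ?_
    simpa only [fourierCoeff_eq_fc, ← h] using sum_sq_fc_le v s
  rw [fourierMultiplier, dif_pos hm]
  refine fc_ext fun l => ?_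
  rw [← repr_eq_fc, LinearIsometryEquiv.apply_symm_apply, h, ← fourierCoeff_eq_fc]

theorem fc_fourierMultiplier_of_bounded {σ : ℤ → ℂ} {C : ℝ} (hσ : ∀ l, ‖σ l‖ ≤ C)
    (u : ComplexL2 L) (l : ℤ) : fc l (fourierMultiplier σ u) = σ l * fc l u := by
  obtain ⟨v, hv⟩ := exists_fc_eq (L := L) (c := fun l => σ l * fc l u) (B := C ^ 2 * ‖u‖ ^ 2)
    fun s => by
      calc ∑ l ∈ s, ‖σ l * fc l u‖ ^ 2 ≤ ∑ l ∈ s, C ^ 2 * ‖fc l u‖ ^ 2 := by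
            gcongr with l _
            rw [norm_mul, mul_pow]
            gcongr
            exact hσ l
        _ ≤ C ^ 2 * ‖u‖ ^ 2 := by
            rw [← Finset.mul_sum]
            gcongr
            exact sum_sq_fc_le u s
  rw [fourierMultiplier_eq_of_fc hv, hv]

theorem fc_japaneseInv (u : ComplexL2 L) (l : ℤ) :
    fc l (japaneseInv u) = (japaneseSymbol L l : ℂ)⁻¹ * fc l u := by
  refine fc_fourierMultiplier_of_bounded (C := 1) (fun l => ?_) u l
  rw [norm_inv, Complex.norm_of_nonneg (japaneseSymbol_pos l).le]
  exact inv_le_one_of_one_le₀ (one_le_japaneseSymbol l)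

theorem fc_propagator (τ : ℝ) (u : ComplexL2 L) (l : ℤ) :
    fc l (propagator τ u) = Complex.exp (Complex.I * τ * japaneseSymbol L l) * fc l u := by
  refine fc_fourierMultiplier_of_bounded (C := 1) (fun l => ?_) u l
  rw [mul_assoc, ← Complex.ofReal_mul, norm_phase]

theorem norm_japaneseInv_le (u : ComplexL2 L) : ‖japaneseInv u‖ ≤ ‖u‖ := by
  have := norm_le_mul_of_norm_fc_le (u := japaneseInv u) (v := u) zero_le_one fun l => by
    rw [fc_japaneseInv, norm_mul, norm_inv, Complex.norm_of_nonneg (japaneseSymbol_pos l).le]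
    gcongr
    exact inv_le_one_of_one_le₀ (one_le_japaneseSymbol l)
  simpa using this

/-- `⟨∇⟩⁻¹` as a linear map. -/
def japaneseInvₗ : ComplexL2 L →ₗ[ℂ] ComplexL2 L where
  toFun := japaneseInv
  map_add' u v := fc_ext fun l => by simp only [fc_japaneseInv, map_add]; ring
  map_smul' c u := fc_ext fun l => by
    simp only [fc_japaneseInv, map_smul, smul_eq_mul, RingHom.id_apply]; ring

/-- `exp (i τ ⟨∇⟩)` as a linear isometry. -/
def propagatorₗᵢ (τ : ℝ) : ComplexL2 L →ₗᵢ[ℂ] ComplexL2 L where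
  toFun := propagator τ
  map_add' u v := fc_ext fun l => by simp only [fc_propagator, map_add]; ring
  map_smul' c u := fc_ext fun l => by
    simp only [fc_propagator, map_smul, smul_eq_mul, RingHom.id_apply]; ring
  norm_map' u := by
    have hn (l : ℤ) : ‖fc l (propagator τ u)‖ = ‖fc l u‖ := by
      rw [fc_propagator, norm_mul, mul_assoc, ← Complex.ofReal_mul, norm_phase, one_mul]
    refine le_antisymm ?_ ?_
    · have := norm_le_mul_of_norm_fc_le (u := propagator τ u) (v := u) zero_le_one fun l => by
        rw [hn, one_mul]
      simpa using this
    · have := norm_le_mul_of_norm_fc_le (u := u) (v := propagator τ u) zero_le_one fun l => by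
        rw [hn, one_mul]
      simpa using this

@[simp] theorem propagatorₗᵢ_apply (τ : ℝ) (u : ComplexL2 L) :
    propagatorₗᵢ τ u = propagator τ u := rfl

theorem propagator_propagator (s t : ℝ) (u : ComplexL2 L) :
    propagator s (propagator t u) = propagator (s + t) u := by
  refine fc_ext fun l => ?_
  rw [fc_propagator, fc_propagator, fc_propagator, ← mul_assoc, ← Complex.exp_add]
  push_cast
  ring_nf

theorem propagator_zero (u : ComplexL2 L) : propagator 0 u = u :=
  fc_ext fun l => by simp [fc_propagator]

theorem norm_propagator (τ : ℝ) (u : ComplexL2 L) : ‖propagator τ u‖ = ‖u‖ :=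
  (propagatorₗᵢ τ).norm_map u

theorem fc_propagator_neg (t : ℝ) (u : ComplexL2 L) (l : ℤ) :
    fc l (propagator (-t) u) = Complex.exp (-(Complex.I * t * japaneseSymbol L l)) * fc l u := by
  rw [fc_propagator]
  push_cast
  ring_nf

/-- A mean value inequality for functions whose Fourier coefficients are differentiable. -/
theorem norm_sub_le_of_hasDerivWithinAt_fc {y g : ℝ → ComplexL2 L} {a b M : ℝ} (hab : a ≤ b)
    (hy : ∀ l, ∀ t ∈ Set.Icc a b,
      HasDerivWithinAt (fun s => fc l (y s)) (fc l (g t)) (Set.Icc a b) t)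
    (hg : ∀ t ∈ Set.Icc a b, ‖g t‖ ≤ M) : ‖y b - y a‖ ≤ M * (b - a) := by
  have hM : 0 ≤ M := (norm_nonneg _).trans (hg a ⟨le_rfl, hab⟩)
  have hbessel (u : ComplexL2 L) (s : Finset ℤ) :
      ‖∑ l ∈ s, fc l u • fourierLp (T := L) 2 l‖ ≤ ‖u‖ := by
    refine norm_le_of_sum_sq_fc_le (norm_nonneg _) fun r => ?_
    calc ∑ k ∈ r, ‖fc k (∑ l ∈ s, fc l u • fourierLp (T := L) 2 l)‖ ^ 2
        ≤ ∑ k ∈ r, ‖fc k u‖ ^ 2 := by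
          gcongr with k _
          simp only [map_sum, map_smul, fc_fourierLp, smul_eq_mul, mul_ite, mul_one, mul_zero,
            Finset.sum_ite_eq]
          split_ifs
          · exact le_rfl
          · simp
      _ ≤ ‖u‖ ^ 2 := sum_sq_fc_le u r
  -- No derivative of `y` in norm is available, only coefficientwise ones. Finite Fourier
  -- projections are genuinely differentiable, Bessel bounds their derivatives by `M`, and the bound
  -- passes to the limit.
  have hproj (s : Finset ℤ) :
      ‖∑ l ∈ s, fc l (y b - y a) • fourierLp (T := L) 2 l‖ ≤ M * (b - a) := by
    have := norm_image_sub_le_of_norm_deriv_le_segment' (a := a) (b := b) (C := M)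
      (f := fun t => ∑ l ∈ s, fc l (y t) • fourierLp (T := L) 2 l)
      (f' := fun t => ∑ l ∈ s, fc l (g t) • fourierLp (T := L) 2 l)
      (fun t ht => HasDerivWithinAt.fun_sum fun l _ => (hy l t ht).smul_const _)
      (fun t ht => (hbessel (g t) s).trans (hg t ⟨ht.1, ht.2.le⟩)) b ⟨hab, le_rfl⟩
    simpa only [map_sub, sub_smul, Finset.sum_sub_distrib] using this
  exact le_of_tendsto (hasSum_fc (y b - y a)).norm (Filter.Eventually.of_forall hproj)

end Fourier

/-! ### Real and complex functions, translations, Sobolev norms. -/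

section RealComplex

theorem fourier_coe_eq_freq {L : ℝ} (l : ℤ) (s : ℝ) :
    fourier l (s : AddCircle L) = Complex.exp (Complex.I * (freq L l * s : ℝ)) := by
  rw [fourier_coe_apply, freq]
  push_cast
  ring_nf

variable {L : ℝ} [Fact (0 < L)]

theorem fc_star (u : ComplexL2 L) (l : ℤ) : fc l (star u) = star (fc (-l) u) := by
  rw [← fourierCoeff_eq_fc, ← fourierCoeff_eq_fc, fourierCoeff, fourierCoeff, RCLike.star_def,
    ← integral_conj]
  refine integral_congr_ae ?_
  filter_upwards [Lp.coeFn_star u] with x hx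
  rw [hx, Pi.star_apply, smul_eq_mul, smul_eq_mul, map_mul, ← fourier_neg, RCLike.star_def, neg_neg]

theorem norm_star_eq (u : ComplexL2 L) : ‖star u‖ = ‖u‖ := by
  refine le_antisymm ?_ ?_ <;>
  · refine Lp.norm_le_norm_of_ae_le ?_
    filter_upwards [Lp.coeFn_star u] with x hx
    rw [hx, Pi.star_apply, norm_star]

theorem coeFn_toComplex (u : RealL2 L) : ∀ᵐ x ∂haarAddCircle, toComplex u x = (u x : ℂ) :=
  Complex.ofRealCLM.coeFn_compLp u

theorem coeFn_realPart (u : ComplexL2 L) : ∀ᵐ x ∂haarAddCircle, realPart u x = (u x).re :=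
  Complex.reCLM.coeFn_compLp u

/-- `toComplex` as a linear map. -/
def toComplexₗ : RealL2 L →ₗ[ℝ] ComplexL2 L :=
  (Complex.ofRealCLM.compLpL 2 haarAddCircle : RealL2 L →L[ℝ] ComplexL2 L)

theorem toComplexₗ_apply (u : RealL2 L) : toComplexₗ u = toComplex u := rfl

theorem toComplex_sub (u v : RealL2 L) : toComplex (u - v) = toComplex u - toComplex v :=
  toComplexₗ.map_sub u v

/-- `realPart` as a linear map. -/
def realPartₗ : ComplexL2 L →ₗ[ℝ] RealL2 L :=
  (Complex.reCLM.compLpL 2 haarAddCircle : ComplexL2 L →L[ℝ] RealL2 L)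

theorem realPart_sub (u v : ComplexL2 L) : realPart (u - v) = realPart u - realPart v :=
  realPartₗ.map_sub u v

theorem norm_toComplex (u : RealL2 L) : ‖toComplex u‖ = ‖u‖ := by
  refine le_antisymm ?_ ?_ <;>
  · refine Lp.norm_le_norm_of_ae_le ?_
    filter_upwards [coeFn_toComplex u] with x hx
    rw [hx, Complex.norm_real]

theorem norm_realPart_le (u : ComplexL2 L) : ‖realPart u‖ ≤ ‖u‖ := by
  refine Lp.norm_le_norm_of_ae_le ?_
  filter_upwards [coeFn_realPart u] with x hx
  rw [hx]
  exact Complex.abs_re_le_norm _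

theorem realPart_toComplex (u : RealL2 L) : realPart (toComplex u) = u := by
  refine Lp.ext ?_
  filter_upwards [coeFn_realPart (toComplex u), coeFn_toComplex u] with x h1 h2
  rw [h1, h2, Complex.ofReal_re]

theorem toComplex_realPart (u : ComplexL2 L) :
    toComplex (realPart u) = (1 / 2 : ℂ) • (u + star u) := by
  refine Lp.ext ?_
  filter_upwards [coeFn_toComplex (realPart u), coeFn_realPart u,
    Lp.coeFn_smul (1 / 2 : ℂ) (u + star u), Lp.coeFn_add u (star u), Lp.coeFn_star u]
    with x h1 h2 h3 h4 h5
  rw [h1, h2, h3, Pi.smul_apply, h4, Pi.add_apply, h5, Pi.star_apply, RCLike.star_def,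
    Complex.add_conj, smul_eq_mul]
  push_cast
  ring

theorem fc_toComplex_neg (u : RealL2 L) (l : ℤ) :
    fc (-l) (toComplex u) = star (fc l (toComplex u)) := by
  have h : star (toComplex u) = toComplex u := by
    refine Lp.ext ?_
    filter_upwards [Lp.coeFn_star (toComplex u), coeFn_toComplex u] with x h1 h2
    rw [h1, Pi.star_apply, h2, RCLike.star_def, Complex.conj_ofReal]
  have := fc_star (toComplex u) (-l)
  rwa [h, neg_neg] at this

theorem fc_toComplex_realPart (u : ComplexL2 L) (l : ℤ) :
    fc l (toComplex (realPart u)) = (1 / 2) * (fc l u + star (fc (-l) u)) := by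
  rw [toComplex_realPart, map_smul, map_add, fc_star, smul_eq_mul]

/-- Translation by `s` on `L²`. -/
def translate (s : ℝ) : RealL2 L → RealL2 L :=
  Lp.compMeasurePreserving (fun x => x + (s : AddCircle L)) (measurePreserving_add_right _ _)

theorem coeFn_translate (s : ℝ) (u : RealL2 L) :
    ∀ᵐ x ∂haarAddCircle, translate s u x = u (x + (s : AddCircle L)) :=
  Lp.coeFn_compMeasurePreserving u (measurePreserving_add_right _ _)

theorem fc_translate (s : ℝ) (u : RealL2 L) (l : ℤ) :
    fc l (toComplex (translate s u))
      = Complex.exp (Complex.I * (freq L l * s : ℝ)) * fc l (toComplex u) := by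
  rw [← fourierCoeff_eq_fc, ← fourierCoeff_eq_fc, fourierCoeff, fourierCoeff,
    ← integral_add_right_eq_self (μ := haarAddCircle)
      (fun t => fourier (-l) t • (toComplex u : AddCircle L → ℂ) t) (s : AddCircle L),
    ← integral_const_mul]
  refine integral_congr_ae ?_
  have h := (measurePreserving_add_right (haarAddCircle (T := L))
    (s : AddCircle L)).quasiMeasurePreserving.ae (coeFn_toComplex u)
  filter_upwards [coeFn_toComplex (translate s u), coeFn_translate s u, h] with x h1 h2 h3
  have hne : fourier l (s : AddCircle L) * fourier (-l) (s : AddCircle L) = 1 := by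
    rw [← fourier_add, add_neg_cancel, fourier_zero]
  have hadd : fourier (-l) (x + (s : AddCircle L))
      = fourier (-l) x * fourier (-l) (s : AddCircle L) := by
    simp only [fourier_apply, smul_add, toCircle_add, Circle.coe_mul]
  rw [h1, h2, h3, smul_eq_mul, smul_eq_mul, hadd, ← fourier_coe_eq_freq]
  linear_combination (-(fourier (-l) x * (u (x + (s : AddCircle L)) : ℂ))) * hne

theorem coeFn_splitTerm (ε : ℝ) (u : RealL2 L) :
    ∀ᵐ x ∂haarAddCircle, splitTerm ε u x = Real.sin (ε * u x) / ε - u x := by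
  filter_upwards [Lp.coeFn_sub (scaledSine ε u) u,
    (lipschitzWith_sin_mul_div ε).coeFn_compLp (by simp) u] with x h1 h2
  rw [splitTerm, h1, Pi.sub_apply, scaledSine, h2]
  rfl

/-- The function `v` plays the role of `⟨∇⟩ˢu`: its existence makes the extended norm finite and
equal to an ordinary `L²` norm. -/
theorem sobolevNorm_eq_of_fc {s : ℕ} {u v : ComplexL2 L}
    (h : ∀ l, ‖fc l v‖ ^ 2 = (1 + freq L l ^ 2) ^ s * ‖fc l u‖ ^ 2) :
    sobolevNorm s u = ENNReal.ofReal ‖v‖ := by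
  have h1 : ∑' l : ℤ, ENNReal.ofReal ((1 + freq L l ^ 2) ^ s * ‖fourierCoeff u l‖ ^ 2)
      = ENNReal.ofReal (‖v‖ ^ 2) := by
    simp only [fourierCoeff_eq_fc, ← h]
    rw [← (hasSum_sq_fc v).tsum_eq,
      ENNReal.ofReal_tsum_of_nonneg (fun _ => by positivity) (summable_sq_fc v)]
  rw [sobolevNorm, h1, ENNReal.ofReal_rpow_of_nonneg (by positivity) (by norm_num),
    ← Real.sqrt_eq_rpow, Real.sqrt_sq (norm_nonneg _)]

theorem sum_le_of_sobolevNorm_le {s : ℕ} {u : ComplexL2 L} {K : ℝ} (hK : 0 ≤ K)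
    (h : sobolevNorm s u ≤ ENNReal.ofReal K) (r : Finset ℤ) :
    ∑ l ∈ r, (1 + freq L l ^ 2) ^ s * ‖fc l u‖ ^ 2 ≤ K ^ 2 := by
  have h1 : ∑' l : ℤ, ENNReal.ofReal ((1 + freq L l ^ 2) ^ s * ‖fourierCoeff u l‖ ^ 2)
      ≤ ENNReal.ofReal (K ^ 2) := by
    have h2 := ENNReal.rpow_le_rpow h (z := 2) (by norm_num)
    rw [sobolevNorm, ← ENNReal.rpow_mul, ENNReal.ofReal_rpow_of_nonneg hK (by norm_num)] at h2
    norm_num at h2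
    exact h2
  simp only [fourierCoeff_eq_fc] at h1
  have h3 := (ENNReal.sum_le_tsum r).trans h1
  rw [← ENNReal.ofReal_sum_of_nonneg (fun _ _ => by positivity)] at h3
  exact (ENNReal.ofReal_le_ofReal_iff (by positivity)).mp h3

end RealComplex

/-! ### Equations and bounds for the Fourier coefficients of a weak solution. -/

section Evolution

theorem isSmooth_fourier {L : ℝ} (l : ℤ) : IsSmooth (L := L) (fourier l) := by
  unfold IsSmooth
  simp only [fourier_coe_eq_freq]
  refine Complex.contDiff_exp.comp (contDiff_const.mul (Complex.ofRealCLM.contDiff.comp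
    (contDiff_const.mul contDiff_id)))

theorem circleDeriv_fourier_mul {L : ℝ} (c : ℂ) (l : ℤ) :
    circleDeriv (L := L) (fun x => c * fourier l x)
      = fun x => (c * (Complex.I * freq L l)) * fourier l x := by
  funext x
  have hadd (h : ℝ) : fourier l (x + (h : AddCircle L))
      = fourier l x * Complex.exp (Complex.I * freq L l * h) := by
    have : fourier l (x + (h : AddCircle L)) = fourier l x * fourier l (h : AddCircle L) := by
      simp only [fourier_apply, smul_add, toCircle_add, Circle.coe_mul]
    rw [this, fourier_coe_eq_freq]
    push_cast
    ring_nf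
  have hd : HasDerivAt (fun h : ℝ => Complex.exp (Complex.I * freq L l * h))
      (Complex.I * freq L l) 0 := by
    have h0 : HasDerivAt (fun h : ℝ => Complex.I * freq L l * (h : ℂ)) (Complex.I * freq L l) 0 := by
      simpa using (Complex.ofRealCLM.hasDerivAt (x := (0 : ℝ))).const_mul (Complex.I * freq L l)
    simpa using h0.cexp
  unfold circleDeriv
  simp only [hadd]
  have := ((hd.const_mul (fourier l x)).const_mul c).deriv
  rw [this]
  ring

variable {L : ℝ} [Fact (0 < L)]

theorem pairing_fourier (u : RealL2 L) (l : ℤ) :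
    pairing u (fourier (-l)) = fc l (toComplex u) := by
  rw [← fourierCoeff_eq_fc, fourierCoeff, pairing]
  refine integral_congr_ae ?_
  filter_upwards [coeFn_toComplex u] with x hx
  rw [hx, smul_eq_mul, mul_comm]

theorem pairing_const_mul (u : RealL2 L) (c : ℂ) (χ : AddCircle L → ℂ) :
    pairing u (fun x => c * χ x) = c * pairing u χ := by
  rw [pairing, pairing, ← integral_const_mul]
  congr 1
  funext x
  ring

variable {ε S : ℝ} {w z : ℝ → RealL2 L}

theorem IsSolution.hasDerivWithinAt_fc_w (h : IsSolution ε S w z) (l : ℤ) {t : ℝ}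
    (ht : t ∈ Set.Icc 0 S) :
    HasDerivWithinAt (fun s => fc l (toComplex (w s))) (fc l (toComplex (z t)))
      (Set.Icc 0 S) t := by
  simpa only [pairing_fourier] using h.deriv_w _ (isSmooth_fourier (-l)) t ht

/-- The weak equation tested with an exponential: two derivatives produce `-μ_l²`, and the linear
part of the sine supplies the further `-1` that completes `-δ_l²`. -/
theorem IsSolution.hasDerivWithinAt_fc_z (h : IsSolution ε S w z) (l : ℤ) {t : ℝ}
    (ht : t ∈ Set.Icc 0 S) :
    HasDerivWithinAt (fun s => fc l (toComplex (z s)))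
      (-(japaneseSymbol L l : ℂ) ^ 2 * fc l (toComplex (w t))
        - fc l (toComplex (splitTerm ε (w t)))) (Set.Icc 0 S) t := by
  have h1 := h.deriv_z _ (isSmooth_fourier (-l)) t ht
  have h2 : circleDeriv (circleDeriv (fourier (T := L) (-l)))
      = fun x => (-(freq L l : ℂ) ^ 2) * fourier (-l) x := by
    have h3 := circleDeriv_fourier_mul (L := L) 1 (-l)
    simp only [one_mul] at h3
    have h4 : (fun x => fourier (T := L) (-l) x) = ⇑(fourier (T := L) (-l)) := rfl
    rw [h4] at h3
    rw [h3, circleDeriv_fourier_mul]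
    funext x
    rw [freq_neg]
    push_cast
    linear_combination ((freq L l : ℂ) ^ 2 * fourier (-l) x) * Complex.I_sq
  rw [h2] at h1
  simp only [pairing_const_mul, pairing_fourier] at h1
  convert h1 using 1
  rw [← Complex.ofReal_pow, sq_japaneseSymbol, splitTerm, toComplex_sub, map_sub]
  push_cast
  ring

/-- The regularity bound holds at every time. -/
theorem RegularityBound.sum_le {m : ℕ} {K : ℝ} (hS : 0 < S) (h : IsSolution ε S w z)
    (hr : RegularityBound m K S w z) {t : ℝ} (ht : t ∈ Set.Icc 0 S) (r : Finset ℤ) :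
    ∑ l ∈ r, (1 + freq L l ^ 2) ^ (m + 1) * ‖fc l (toComplex (w t))‖ ^ 2 ≤ (max K 0) ^ 2 ∧
    ∑ l ∈ r, (1 + freq L l ^ 2) ^ m * ‖fc l (toComplex (z t))‖ ^ 2 ≤ (max K 0) ^ 2 := by
  set G : Set ℝ := {t ∈ Set.Icc (0 : ℝ) S |
    sobolevNorm (m + 1) (toComplex (w t)) ≤ ENNReal.ofReal K ∧
      sobolevNorm m (toComplex (z t)) ≤ ENNReal.ofReal K} with hG
  have hKK : ENNReal.ofReal K ≤ ENNReal.ofReal (max K 0) := ENNReal.ofReal_le_ofReal (le_max_left _ _)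
  have hdense : Set.Icc (0 : ℝ) S ⊆ closure G := by
    rw [← closure_Ioo hS.ne]
    refine closure_minimal (fun t ht => ?_) isClosed_closure
    rw [mem_closure_iff_nhds]
    intro U hU
    have hr' : ∀ᵐ t ∂(volume : Measure ℝ), t ∈ Set.Icc (0 : ℝ) S → t ∈ G := by
      have := (ae_restrict_iff' measurableSet_Icc).mp hr
      filter_upwards [this] with t ht h0 using ⟨h0, ht h0⟩
    have hne : ∃ᶠ x in ae (volume : Measure ℝ), x ∈ U ∩ Set.Ioo (0 : ℝ) S :=
      frequently_ae_mem_iff.mpr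
        (Measure.measure_pos_of_mem_nhds _ (Filter.inter_mem hU (Ioo_mem_nhds ht.1 ht.2))).ne'
    obtain ⟨x, hx, hx2⟩ := (hne.and_eventually hr').exists
    exact ⟨x, hx.1, hx2 ⟨hx.2.1.le, hx.2.2.le⟩⟩
  have hGS : G ⊆ Set.Icc 0 S := fun t ht => ht.1
  have hmem : (nhdsWithin t G).NeBot := mem_closure_iff_nhdsWithin_neBot.mp (hdense ht)
  have hcw (l : ℤ) : Filter.Tendsto (fun s => fc l (toComplex (w s))) (nhdsWithin t G)
      (nhds (fc l (toComplex (w t)))) :=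
    ((h.hasDerivWithinAt_fc_w l ht).continuousWithinAt.mono hGS)
  have hcz (l : ℤ) : Filter.Tendsto (fun s => fc l (toComplex (z s))) (nhdsWithin t G)
      (nhds (fc l (toComplex (z t)))) :=
    ((h.hasDerivWithinAt_fc_z l ht).continuousWithinAt.mono hGS)
  constructor
  · refine le_of_tendsto (tendsto_finsetSum r fun l _ => ((hcw l).norm.pow 2).const_mul _) ?_
    filter_upwards [self_mem_nhdsWithin] with s hs
    exact sum_le_of_sobolevNorm_le (le_max_right _ _) (hs.2.1.trans hKK) r
  · refine le_of_tendsto (tendsto_finsetSum r fun l _ => ((hcz l).norm.pow 2).const_mul _) ?_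
    filter_upwards [self_mem_nhdsWithin] with s hs
    exact sum_le_of_sobolevNorm_le (le_max_right _ _) (hs.2.2.trans hKK) r

end Evolution

/-! ### Pointwise estimates for the sine, its cubic approximation and the truncated cube. -/

section Scalar

theorem norm_cube_sub_cube_le {𝕜 : Type*} [NormedField 𝕜] {a b : 𝕜} {R : ℝ} (ha : ‖a‖ ≤ R)
    (hb : ‖b‖ ≤ R) : ‖a ^ 3 - b ^ 3‖ ≤ 3 * R ^ 2 * ‖a - b‖ := by
  have h : a ^ 3 - b ^ 3 = (a ^ 2 + a * b + b ^ 2) * (a - b) := by ring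
  rw [h, norm_mul]
  gcongr
  calc ‖a ^ 2 + a * b + b ^ 2‖ ≤ ‖a‖ ^ 2 + ‖a‖ * ‖b‖ + ‖b‖ ^ 2 := by
        refine (norm_add₃_le).trans ?_
        rw [norm_pow, norm_mul, norm_pow]
    _ ≤ R ^ 2 + R * R + R ^ 2 := by gcongr; exact (norm_nonneg a).trans ha
    _ = 3 * R ^ 2 := by ring

/-- Taylor's bound serves for `|y| ≤ 1`. For `|y| ≥ 1` the left side is nonnegative and at most
`y²/2 ≤ y⁴/2`, so no smallness of `y` is required. -/
theorem abs_cos_sub_one_add_sq_le (y : ℝ) : |Real.cos y - 1 + y ^ 2 / 2| ≤ y ^ 4 / 2 := by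
  rcases le_total |y| 1 with h | h
  · have := Real.cos_bound h
    have h4 : |y| ^ 4 = y ^ 4 := Even.pow_abs (by decide) y
    rw [h4] at this
    rw [show Real.cos y - 1 + y ^ 2 / 2 = Real.cos y - (1 - y ^ 2 / 2) by ring]
    have : 0 ≤ y ^ 4 := by positivity
    linarith
  · have h1 : 1 ≤ y ^ 2 := by rw [← sq_abs]; nlinarith
    rw [abs_of_nonneg (by linarith [Real.one_sub_sq_div_two_le_cos (x := y)])]
    nlinarith [Real.cos_le_one y]

theorem abs_sub_le_of_abs_deriv_le {g g' : ℝ → ℝ} {R C x y : ℝ} (hg : ∀ t, HasDerivAt g (g' t) t)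
    (hC : ∀ t, |t| ≤ R → |g' t| ≤ C) (hx : |x| ≤ R) (hy : |y| ≤ R) :
    |g x - g y| ≤ C * |x - y| :=
  (convex_Icc (-R) R).norm_image_sub_le_of_norm_hasDerivWithin_le
    (fun t _ => (hg t).hasDerivWithinAt) (fun t ht => hC t (abs_le.mpr ht)) (abs_le.mp hy)
    (abs_le.mp hx)

theorem hasDerivAt_sin_mul_div {ε : ℝ} (hε : 0 < ε) (t : ℝ) :
    HasDerivAt (fun x => Real.sin (ε * x) / ε) (Real.cos (ε * t)) t := by
  have h := (((hasDerivAt_id t).const_mul ε).sin).div_const ε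
  simpa [hε.ne'] using h

/-- The derivative is `cos (εt) - 1`, which lies between `-ε²R²/2` and `0`. -/
theorem abs_sin_split_sub_le {ε R x y : ℝ} (hε : 0 < ε) (hx : |x| ≤ R) (hy : |y| ≤ R) :
    |(Real.sin (ε * x) / ε - x) - (Real.sin (ε * y) / ε - y)| ≤ ε ^ 2 * R ^ 2 / 2 * |x - y| := by
  refine abs_sub_le_of_abs_deriv_le (g := fun x => Real.sin (ε * x) / ε - x)
    (fun t => (hasDerivAt_sin_mul_div hε t).sub (hasDerivAt_id t)) (fun t ht => ?_) hx hy
  have h1 : t ^ 2 ≤ R ^ 2 := by rw [← sq_abs]; gcongr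
  rw [abs_of_nonpos (by linarith [Real.cos_le_one (ε * t)])]
  nlinarith [Real.one_sub_sq_div_two_le_cos (x := ε * t), mul_le_mul_of_nonneg_left h1 (sq_nonneg ε)]

/-- Adding back the cube cancels the quadratic term of the derivative `cos (εt) - 1`, which gains a
second factor `ε²`. -/
theorem abs_sin_split_add_cube_sub_le {ε R x y : ℝ} (hε : 0 < ε) (hx : |x| ≤ R) (hy : |y| ≤ R) :
    |(Real.sin (ε * x) / ε - x + ε ^ 2 / 6 * x ^ 3)
        - (Real.sin (ε * y) / ε - y + ε ^ 2 / 6 * y ^ 3)| ≤ ε ^ 4 * R ^ 4 / 2 * |x - y| := by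
  refine abs_sub_le_of_abs_deriv_le (g := fun x => Real.sin (ε * x) / ε - x + ε ^ 2 / 6 * x ^ 3)
    (fun t => ((hasDerivAt_sin_mul_div hε t).sub (hasDerivAt_id t)).add
      ((hasDerivAt_pow 3 t).const_mul _)) (fun t ht => ?_) hx hy
  have h1 : t ^ 4 ≤ R ^ 4 := by rw [← Even.pow_abs (n := 4) (by decide) t]; gcongr
  have h2 := abs_cos_sub_one_add_sq_le (ε * t)
  calc _ = |Real.cos (ε * t) - 1 + (ε * t) ^ 2 / 2| := by
        congr 1
        push_cast
        ring
    _ ≤ (ε * t) ^ 4 / 2 := h2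
    _ = ε ^ 4 * t ^ 4 / 2 := by ring
    _ ≤ ε ^ 4 * R ^ 4 / 2 := by gcongr

/-- Truncation of a real number to `[-R, R]`. -/
def clamp (R x : ℝ) : ℝ := max (min x R) (-R)

theorem clamp_of_abs_le {R x : ℝ} (h : |x| ≤ R) : clamp R x = x := by
  rw [clamp, min_eq_left (abs_le.mp h).2, max_eq_left (abs_le.mp h).1]

theorem abs_clamp_le {R : ℝ} (hR : 0 ≤ R) (x : ℝ) : |clamp R x| ≤ R :=
  abs_le.mpr ⟨le_max_right _ _, max_le (min_le_right _ _) (by linarith)⟩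

theorem abs_clamp_sub_le (R x y : ℝ) : |clamp R x - clamp R y| ≤ |x - y| :=
  (abs_max_sub_max_le_abs _ _ _).trans <| by
    have := abs_min_sub_min_le_max x R y R
    simpa using this

theorem lipschitzWith_clamp_cube (R : NNReal) :
    LipschitzWith (3 * R ^ 2) (fun x : ℝ => clamp R x ^ 3) := by
  refine LipschitzWith.of_dist_le_mul fun x y => ?_
  rw [Real.dist_eq, Real.dist_eq]
  have h := norm_cube_sub_cube_le (𝕜 := ℝ) (abs_clamp_le R.2 x) (abs_clamp_le R.2 y)
  refine h.trans ?_
  push_cast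
  exact mul_le_mul_of_nonneg_left (abs_clamp_sub_le _ _ _) (by positivity)

end Scalar

/-! ### The embedding of `H¹` into the functions with absolutely summable Fourier series. -/

section Sobolev

theorem summable_inv_sq_japaneseSymbol {L : ℝ} (hL : 0 < L) :
    Summable (fun l : ℤ => (japaneseSymbol L l)⁻¹ ^ 2) := by
  have h := ((Real.summable_one_div_int_pow (p := 2)).mpr (by norm_num)).mul_left
    ((L / (2 * Real.pi)) ^ 2)
  refine Summable.of_norm_bounded_eventually h ?_
  have h0 : {(0 : ℤ)}ᶜ ∈ Filter.cofinite := (Set.finite_singleton (0 : ℤ)).compl_mem_cofinite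
  filter_upwards [h0] with l hl
  have hl' : (l : ℝ) ≠ 0 := Int.cast_ne_zero.mpr hl
  rw [Real.norm_of_nonneg (by positivity), inv_pow, sq_japaneseSymbol, freq]
  have hπ := Real.pi_pos
  rw [inv_le_comm₀ (by positivity) (by positivity)]
  have : ((L / (2 * Real.pi)) ^ 2 * (1 / (l : ℝ) ^ 2))⁻¹ = (2 * Real.pi * l / L) ^ 2 := by
    field_simp
  rw [this]
  linarith

/-- The constant of the embedding of `H¹` into the functions with summable Fourier series. -/
def sobolevConst (L : ℝ) : ℝ := Real.sqrt (∑' l : ℤ, (japaneseSymbol L l)⁻¹ ^ 2)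

theorem sobolevConst_nonneg {L : ℝ} : 0 ≤ sobolevConst L := Real.sqrt_nonneg _

variable {L : ℝ} [hL : Fact (0 < L)]

/-- Cauchy–Schwarz against the square-summable sequence `δ_l⁻¹`. Everything nonlinear rests on this:
it bounds waves pointwise and sums the amplitudes in the cubic form. -/
theorem sum_inv_mul_norm_fc_le (v : ComplexL2 L) (s : Finset ℤ) :
    ∑ l ∈ s, (japaneseSymbol L l)⁻¹ * ‖fc l v‖ ≤ sobolevConst L * ‖v‖ := by
  refine le_of_sq_le_sq ?_ (mul_nonneg sobolevConst_nonneg (norm_nonneg _))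
  calc (∑ l ∈ s, (japaneseSymbol L l)⁻¹ * ‖fc l v‖) ^ 2
      ≤ (∑ l ∈ s, (japaneseSymbol L l)⁻¹ ^ 2) * ∑ l ∈ s, ‖fc l v‖ ^ 2 :=
        Finset.sum_mul_sq_le_sq_mul_sq _ _ _
    _ ≤ (∑' l : ℤ, (japaneseSymbol L l)⁻¹ ^ 2) * ‖v‖ ^ 2 := by
        gcongr
        · exact (summable_inv_sq_japaneseSymbol hL.out).sum_le_tsum s fun _ _ => by positivity
        · exact sum_sq_fc_le v s
    _ = (sobolevConst L * ‖v‖) ^ 2 := by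
        rw [mul_pow, sobolevConst, Real.sq_sqrt (tsum_nonneg fun _ => by positivity)]

/-- A function with summable Fourier coefficients is bounded. -/
theorem ae_norm_le_of_sum_fc_le {u : ComplexL2 L} {A : ℝ}
    (h : ∀ s : Finset ℤ, ∑ l ∈ s, ‖fc l u‖ ≤ A) : ∀ᵐ x ∂haarAddCircle, ‖u x‖ ≤ A := by
  have hs : Summable (fun l => ‖fc l u • fourier (T := L) l‖) := by
    simp only [norm_smul, fourier_norm, mul_one]
    exact summable_of_sum_le (fun _ => norm_nonneg _) h
  set g : C(AddCircle L, ℂ) := ∑' l, fc l u • fourier l with hg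
  have hgA : ‖g‖ ≤ A := by
    refine (norm_tsum_le_tsum_norm hs).trans ?_
    simp only [norm_smul, fourier_norm, mul_one] at hs ⊢
    exact hs.tsum_le_of_sum_le h
  have h1 : HasSum (fun l => fc l u • fourierLp (T := L) 2 l)
      (ContinuousMap.toLp 2 haarAddCircle ℂ g) := by
    have := (ContinuousMap.toLp (E := ℂ) 2 (haarAddCircle (T := L)) ℂ).hasSum hs.of_norm.hasSum
    simpa only [map_smul] using this
  have hu : u = ContinuousMap.toLp 2 haarAddCircle ℂ g := (hasSum_fc u).unique h1
  filter_upwards [ContinuousMap.coeFn_toLp (E := ℂ) (p := 2) haarAddCircle (𝕜 := ℂ) g] with x hx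
  rw [hu, hx]
  exact (g.norm_coe_le_norm x).trans hgA

/-- The real function `w` determined by `⟨∇⟩ w - i ∂ₜ w`. -/
def wave (v : ComplexL2 L) : RealL2 L := realPart (japaneseInv v)

theorem wave_sub (u v : ComplexL2 L) : wave (u - v) = wave u - wave v := by
  rw [wave, wave, wave, ← realPart_sub]
  congr 1
  exact japaneseInvₗ.map_sub u v

theorem fc_wave (v : ComplexL2 L) (l : ℤ) :
    fc l (toComplex (wave v)) = (japaneseSymbol L l : ℂ)⁻¹ * fc l (toComplex (realPart v)) := by
  rw [wave, fc_toComplex_realPart, fc_toComplex_realPart, fc_japaneseInv, fc_japaneseInv,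
    japaneseSymbol_neg, star_mul', star_inv₀, RCLike.star_def, Complex.conj_ofReal]
  ring

theorem norm_wave_le (v : ComplexL2 L) : ‖wave v‖ ≤ ‖v‖ :=
  (norm_realPart_le _).trans (norm_japaneseInv_le v)

theorem ae_abs_wave_le (v : ComplexL2 L) :
    ∀ᵐ x ∂haarAddCircle, |wave v x| ≤ sobolevConst L * ‖v‖ := by
  have h := ae_norm_le_of_sum_fc_le (u := japaneseInv v) (A := sobolevConst L * ‖v‖) fun s => by
    refine le_trans (le_of_eq ?_) (sum_inv_mul_norm_fc_le v s)
    refine Finset.sum_congr rfl fun l _ => ?_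
    rw [fc_japaneseInv, norm_mul, norm_inv, Complex.norm_of_nonneg (japaneseSymbol_pos l).le]
  filter_upwards [h, coeFn_realPart (japaneseInv v)] with x h1 h2
  rw [wave, h2]
  exact (Complex.abs_re_le_norm _).trans h1

theorem ae_abs_wave_le_of_le {v : ComplexL2 L} {R : ℝ} (h : sobolevConst L * ‖v‖ ≤ R) :
    ∀ᵐ x ∂haarAddCircle, |wave v x| ≤ R := by
  filter_upwards [ae_abs_wave_le v] with x hx using hx.trans h

end Sobolev

/-! ### The nonlinearity on `L²` and its behaviour under translation and the propagator. -/

section Nonlinearity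

variable {L : ℝ} [Fact (0 < L)] {ε R : ℝ}

theorem norm_splitTerm_sub_le (hε : 0 < ε) {u v : RealL2 L}
    (hu : ∀ᵐ x ∂haarAddCircle, |u x| ≤ R) (hv : ∀ᵐ x ∂haarAddCircle, |v x| ≤ R) :
    ‖splitTerm ε u - splitTerm ε v‖ ≤ ε ^ 2 * R ^ 2 / 2 * ‖u - v‖ := by
  refine Lp.norm_le_mul_norm_of_ae_le_mul ?_
  filter_upwards [hu, hv, coeFn_splitTerm ε u, coeFn_splitTerm ε v, Lp.coeFn_sub u v,
    Lp.coeFn_sub (splitTerm ε u) (splitTerm ε v)] with x h1 h2 h3 h4 h5 h6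
  rw [h5, h6, Pi.sub_apply, Pi.sub_apply, h3, h4]
  exact abs_sin_split_sub_le hε h1 h2

theorem splitTerm_zero : splitTerm ε (0 : RealL2 L) = 0 := by
  rw [splitTerm, scaledSine, LipschitzWith.compLp_zero, sub_zero]

theorem norm_splitTerm_le (hε : 0 < ε) {u : RealL2 L}
    (hu : ∀ᵐ x ∂haarAddCircle, |u x| ≤ R) (hR : 0 ≤ R) :
    ‖splitTerm ε u‖ ≤ ε ^ 2 * R ^ 2 / 2 * ‖u‖ := by
  have h := norm_splitTerm_sub_le (v := (0 : RealL2 L)) hε hu (by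
    filter_upwards [Lp.coeFn_zero ℝ 2 (haarAddCircle (T := L))] with x hx
    rw [hx]
    simpa using hR)
  rwa [splitTerm_zero, sub_zero, sub_zero] at h

/-- The cube of the truncation of `u` to `[-R, R]`. -/
def clampCube (R : NNReal) (u : RealL2 L) : RealL2 L :=
  (lipschitzWith_clamp_cube R).compLp (by simp [clamp]) u

theorem coeFn_clampCube (R : NNReal) (u : RealL2 L) :
    ∀ᵐ x ∂haarAddCircle, clampCube R u x = clamp R (u x) ^ 3 :=
  (lipschitzWith_clamp_cube R).coeFn_compLp _ u

/-- The nonlinearity after its cubic part is removed. -/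
def quinticTerm (R : NNReal) (ε : ℝ) (u : RealL2 L) : RealL2 L :=
  splitTerm ε u + (ε ^ 2 / 6) • clampCube R u

theorem coeFn_quinticTerm (R : NNReal) (ε : ℝ) (u : RealL2 L) :
    ∀ᵐ x ∂haarAddCircle, quinticTerm R ε u x
      = Real.sin (ε * u x) / ε - u x + ε ^ 2 / 6 * clamp R (u x) ^ 3 := by
  filter_upwards [coeFn_splitTerm ε u, coeFn_clampCube R u,
    Lp.coeFn_add (splitTerm ε u) ((ε ^ 2 / 6) • clampCube R u),
    Lp.coeFn_smul (ε ^ 2 / 6) (clampCube R u)] with x h1 h2 h3 h4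
  rw [quinticTerm, h3, Pi.add_apply, h4, Pi.smul_apply, h1, h2, smul_eq_mul]

theorem norm_quinticTerm_sub_le {R : NNReal} (hε : 0 < ε) {u v : RealL2 L}
    (hu : ∀ᵐ x ∂haarAddCircle, |u x| ≤ R) (hv : ∀ᵐ x ∂haarAddCircle, |v x| ≤ R) :
    ‖quinticTerm R ε u - quinticTerm R ε v‖ ≤ ε ^ 4 * R ^ 4 / 2 * ‖u - v‖ := by
  refine Lp.norm_le_mul_norm_of_ae_le_mul ?_
  filter_upwards [hu, hv, coeFn_quinticTerm R ε u, coeFn_quinticTerm R ε v, Lp.coeFn_sub u v,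
    Lp.coeFn_sub (quinticTerm R ε u) (quinticTerm R ε v)] with x h1 h2 h3 h4 h5 h6
  rw [h5, h6, Pi.sub_apply, Pi.sub_apply, h3, h4, clamp_of_abs_le h1, clamp_of_abs_le h2]
  exact abs_sin_split_add_cube_sub_le hε h1 h2

theorem norm_quinticTerm_le {R : NNReal} (hε : 0 < ε) {u : RealL2 L}
    (hu : ∀ᵐ x ∂haarAddCircle, |u x| ≤ R) :
    ‖quinticTerm R ε u‖ ≤ ε ^ 4 * R ^ 4 / 2 * ‖u‖ := by
  have h := norm_quinticTerm_sub_le (v := (0 : RealL2 L)) hε hu (by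
    filter_upwards [Lp.coeFn_zero ℝ 2 (haarAddCircle (T := L))] with x hx
    rw [hx]
    simp)
  have h0 : quinticTerm R ε (0 : RealL2 L) = 0 := by
    rw [quinticTerm, clampCube, LipschitzWith.compLp_zero, splitTerm_zero, smul_zero, add_zero]
  rwa [h0, sub_zero, sub_zero] at h

theorem ae_translate {p : AddCircle L → Prop} (s : ℝ) (h : ∀ᵐ x ∂haarAddCircle, p x) :
    ∀ᵐ x ∂haarAddCircle, p (x + (s : AddCircle L)) :=
  (measurePreserving_add_right (haarAddCircle (T := L))
    (s : AddCircle L)).quasiMeasurePreserving.ae h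

theorem translate_quinticTerm (R : NNReal) (ε s : ℝ) (u : RealL2 L) :
    translate s (quinticTerm R ε u) = quinticTerm R ε (translate s u) := by
  refine Lp.ext ?_
  filter_upwards [coeFn_translate s (quinticTerm R ε u), coeFn_translate s u,
    ae_translate s (coeFn_quinticTerm R ε u), coeFn_quinticTerm R ε (translate s u)]
    with x h1 h2 h3 h4
  rw [h1, h3, h4, h2]

theorem norm_phase_sub_one_le (x : ℝ) : ‖Complex.exp (Complex.I * x) - 1‖ ≤ |x| := by
  simpa using Real.norm_exp_I_mul_ofReal_sub_one_le (x := x)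

/-- A wave has one derivative more than `v`: the factor `|e^{iμs} - 1| ≤ |μ||s|` is absorbed by
`δ⁻¹`. -/
theorem norm_translate_sub_le (v : ComplexL2 L) (s : ℝ) :
    ‖translate s (wave v) - wave v‖ ≤ |s| * ‖v‖ := by
  rw [← norm_toComplex, toComplex_sub]
  refine (norm_le_mul_of_norm_fc_le (v := toComplex (realPart v)) (abs_nonneg s) fun l => ?_).trans
    (by gcongr; rw [norm_toComplex]; exact norm_realPart_le v)
  rw [map_sub, fc_translate, ← sub_one_mul, fc_wave, norm_mul, norm_mul, ← mul_assoc]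
  gcongr
  rw [norm_inv, Complex.norm_of_nonneg (japaneseSymbol_pos l).le, ← div_eq_mul_inv,
    div_le_iff₀ (japaneseSymbol_pos l)]
  refine (norm_phase_sub_one_le _).trans ?_
  rw [abs_mul, mul_comm]
  gcongr
  exact Real.abs_le_sqrt (by linarith)

theorem abs_japaneseSymbol_sub_abs_freq_le (L : ℝ) (l : ℤ) :
    |japaneseSymbol L l - abs (freq L l)| ≤ 1 := by
  have h1 : |freq L l| ≤ japaneseSymbol L l := Real.abs_le_sqrt (by linarith)
  rw [abs_of_nonneg (by linarith)]
  have h2 : japaneseSymbol L l ≤ 1 + |freq L l| := by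
    rw [japaneseSymbol, Real.sqrt_le_left (by positivity)]
    nlinarith [sq_abs (freq L l), abs_nonneg (freq L l)]
  linarith

/-- Since `|δ - |μ|| ≤ 1`, the half-wave propagator differs from translation at most by `|s|` mode
by mode; the sign of `μ` is irrelevant for `|e^{iμs} - 1|`. Translations commute with pointwise
nonlinearities, so this replaces an `H¹` estimate and a chain rule. -/
theorem norm_propagator_sub_self_le (u : RealL2 L) (s : ℝ) :
    ‖propagator (-s) (toComplex u) - toComplex u‖ ≤ |s| * ‖u‖ + ‖translate s u - u‖ := by
  rw [← norm_toComplex u, ← norm_toComplex (translate s u - u), toComplex_sub]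
  refine norm_le_of_norm_fc_le_add (abs_nonneg s) fun l => ?_
  rw [map_sub, map_sub, fc_propagator_neg, fc_translate, ← sub_one_mul, ← sub_one_mul, norm_mul,
    norm_mul, ← add_mul]
  gcongr
  set δ := japaneseSymbol L l
  set μ := freq L l
  have h1 : ‖Complex.exp (Complex.I * (|μ| * s : ℝ)) - 1‖
      = ‖Complex.exp (Complex.I * (μ * s : ℝ)) - 1‖ := by
    rcases abs_choice μ with h | h
    · rw [h]
    · rw [h, ← Complex.norm_conj]
      simp only [map_sub, map_one, ← Complex.exp_conj, map_mul, Complex.conj_I, Complex.conj_ofReal]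
      push_cast
      ring_nf
  have h2 : ‖Complex.exp (-(Complex.I * s * δ)) - 1‖
      = ‖Complex.exp (Complex.I * (δ * s : ℝ)) - 1‖ := by
    rw [← Complex.norm_conj]
    simp only [map_sub, map_one, ← Complex.exp_conj, map_mul, map_neg, Complex.conj_I,
      Complex.conj_ofReal]
    push_cast
    ring_nf
  have h3 : Complex.exp (Complex.I * (δ * s : ℝ)) - 1
      = Complex.exp (Complex.I * (|μ| * s : ℝ)) * (Complex.exp (Complex.I * ((δ - |μ|) * s : ℝ)) - 1)
        + (Complex.exp (Complex.I * (|μ| * s : ℝ)) - 1) := by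
    rw [mul_sub, ← Complex.exp_add]
    push_cast
    ring_nf
  rw [h2, h3, ← h1]
  refine (norm_add_le _ _).trans ?_
  gcongr
  rw [norm_mul, norm_phase, one_mul]
  refine (norm_phase_sub_one_le _).trans ?_
  rw [abs_mul]
  exact mul_le_of_le_one_left (abs_nonneg s) (abs_japaneseSymbol_sub_abs_freq_le L l)

end Nonlinearity

/-! ### The cubic term as a sum over triples of modes. -/

section Trilinear

variable {L : ℝ} [Fact (0 < L)]

/-- The amplitude of the mode `(l, ±)` in the wave determined by `v`. -/
def amp (v : ComplexL2 L) (p : ℤ × Bool) : ℂ :=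
  (1 / 2) * ((japaneseSymbol L p.1 : ℂ)⁻¹ * if p.2 then fc p.1 v else fc p.1 (star v))

/-- The frequency `± δ_l` of the mode `(l, ±)`. -/
def modeFreq (L : ℝ) (p : ℤ × Bool) : ℝ :=
  if p.2 then japaneseSymbol L p.1 else -japaneseSymbol L p.1

theorem amp_sub (u v : ComplexL2 L) (p : ℤ × Bool) : amp (u - v) p = amp u p - amp v p := by
  unfold amp
  split_ifs
  · rw [map_sub]; ring
  · simp only [fc_star, map_sub, star_sub]; ring

theorem amp_propagator (t : ℝ) (v : ComplexL2 L) (p : ℤ × Bool) :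
    amp (propagator t v) p = Complex.exp (Complex.I * (modeFreq L p * t : ℝ)) * amp v p := by
  unfold amp modeFreq
  split_ifs
  · rw [fc_propagator]
    push_cast
    ring_nf
  · simp only [fc_star, fc_propagator, star_mul', RCLike.star_def, ← Complex.exp_conj, map_mul,
      Complex.conj_I, Complex.conj_ofReal, japaneseSymbol_neg]
    push_cast
    ring_nf

/-- The two halves, from `v` and from its conjugate, each contribute half of the bound of
`sum_inv_mul_norm_fc_le`, uniformly in the truncation. -/
theorem sum_norm_amp_le (s : Finset ℤ) (v : ComplexL2 L) :
    ∑ p ∈ s ×ˢ Finset.univ, ‖amp v p‖ ≤ sobolevConst L * ‖v‖ := by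
  have h (l : ℤ) : ∑ b : Bool, ‖amp v (l, b)‖
      = 1 / 2 * ((japaneseSymbol L l)⁻¹ * ‖fc l v‖)
        + 1 / 2 * ((japaneseSymbol L l)⁻¹ * ‖fc l (star v)‖) := by
    simp only [Fintype.sum_bool, amp, if_true, Bool.false_eq_true, if_false, norm_mul, norm_inv,
      Complex.norm_of_nonneg (japaneseSymbol_pos l).le]
    norm_num
  rw [Finset.sum_product]
  simp only [h]
  rw [Finset.sum_add_distrib, ← Finset.mul_sum, ← Finset.mul_sum]
  have h1 := sum_inv_mul_norm_fc_le v s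
  have h2 := sum_inv_mul_norm_fc_le (star v) s
  rw [norm_star_eq] at h2
  linarith

/-- Triples of modes. -/
abbrev Triple : Type := (ℤ × Bool) × (ℤ × Bool) × (ℤ × Bool)

/-- The triples of modes with wave numbers in `s`. -/
def triples (s : Finset ℤ) : Finset Triple :=
  (s ×ˢ Finset.univ) ×ˢ (s ×ˢ Finset.univ) ×ˢ (s ×ˢ Finset.univ)

/-- The wave number produced by the interaction of three modes. -/
def Triple.mode (Q : Triple) : ℤ := Q.1.1 + Q.2.1.1 + Q.2.2.1

/-- The sum of the frequencies of three modes. -/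
def Triple.freqSum (L : ℝ) (Q : Triple) : ℝ :=
  modeFreq L Q.1 + modeFreq L Q.2.1 + modeFreq L Q.2.2

/-- The resonance function of the cubic interaction. -/
def Triple.phase (L : ℝ) (Q : Triple) : ℝ := Q.freqSum L - japaneseSymbol L Q.mode

/-- The product of the amplitudes of three modes. -/
def amp₃ (v : ComplexL2 L) (Q : Triple) : ℂ := amp v Q.1 * amp v Q.2.1 * amp v Q.2.2

/-- The cubic expression with symbol `m` in the wave determined by `v`, truncated to the wave
numbers in `s`. -/
def cubicForm (s : Finset ℤ) (m : Triple → ℂ) (v : ComplexL2 L) : ComplexL2 L :=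
  ∑ Q ∈ triples s, (m Q * amp₃ v Q) • fourierLp 2 Q.mode

theorem sum_triples_mul {A : Type*} [CommSemiring A] (s : Finset ℤ) (f g h : ℤ × Bool → A) :
    ∑ Q ∈ triples s, f Q.1 * g Q.2.1 * h Q.2.2
      = (∑ p ∈ s ×ˢ Finset.univ, f p) * (∑ p ∈ s ×ˢ Finset.univ, g p)
        * ∑ p ∈ s ×ˢ Finset.univ, h p := by
  rw [triples, Finset.sum_product, mul_assoc, Finset.sum_mul]
  refine Finset.sum_congr rfl fun p _ => ?_
  rw [Finset.sum_product, Finset.sum_mul, Finset.mul_sum]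
  refine Finset.sum_congr rfl fun q _ => ?_
  rw [Finset.mul_sum, Finset.mul_sum]
  exact Finset.sum_congr rfl fun r _ => by ring

theorem norm_fourierLp (l : ℤ) : ‖fourierLp (T := L) 2 l‖ = 1 := orthonormal_fourier.1 l

theorem norm_sum_triples_smul_le (s : Finset ℤ) (c : Triple → ℂ) :
    ‖∑ Q ∈ triples s, c Q • fourierLp (T := L) 2 Q.mode‖ ≤ ∑ Q ∈ triples s, ‖c Q‖ := by
  refine (norm_sum_le _ _).trans (Finset.sum_le_sum fun Q _ => ?_)
  rw [norm_smul, norm_fourierLp, mul_one]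

/-- Absolute summability of the amplitudes allows the triangle inequality over all triples, so any
bounded symbol is admissible and the constant does not depend on `s`. -/
theorem norm_cubicForm_le {s : Finset ℤ} {m : Triple → ℂ} {A : ℝ} (hA : 0 ≤ A)
    (hm : ∀ Q ∈ triples s, ‖m Q‖ ≤ A) (v : ComplexL2 L) :
    ‖cubicForm s m v‖ ≤ A * (sobolevConst L * ‖v‖) ^ 3 := by
  have h0 : 0 ≤ ∑ p ∈ s ×ˢ Finset.univ, ‖amp v p‖ := Finset.sum_nonneg fun _ _ => norm_nonneg _
  calc ‖cubicForm s m v‖ ≤ ∑ Q ∈ triples s, ‖m Q * amp₃ v Q‖ := norm_sum_triples_smul_le _ _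
    _ ≤ ∑ Q ∈ triples s, A * (‖amp v Q.1‖ * ‖amp v Q.2.1‖ * ‖amp v Q.2.2‖) := by
        refine Finset.sum_le_sum fun Q hQ => ?_
        rw [norm_mul, amp₃, norm_mul, norm_mul]
        gcongr
        exact hm Q hQ
    _ = A * (∑ p ∈ s ×ˢ Finset.univ, ‖amp v p‖) ^ 3 := by
        rw [← Finset.mul_sum, sum_triples_mul s (fun p => ‖amp v p‖) (fun p => ‖amp v p‖)
          (fun p => ‖amp v p‖)]
        ring
    _ ≤ A * (sobolevConst L * ‖v‖) ^ 3 := by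
        gcongr
        exact sum_norm_amp_le s v

theorem norm_cubicForm_sub_le {s : Finset ℤ} {m : Triple → ℂ} {A R : ℝ} (hA : 0 ≤ A)
    (hm : ∀ Q ∈ triples s, ‖m Q‖ ≤ A) {u v : ComplexL2 L}
    (hu : sobolevConst L * ‖u‖ ≤ R) (hv : sobolevConst L * ‖v‖ ≤ R) :
    ‖cubicForm s m u - cubicForm s m v‖ ≤ A * (3 * R ^ 2 * (sobolevConst L * ‖u - v‖)) := by
  have h0 (v : ComplexL2 L) : 0 ≤ ∑ p ∈ s ×ˢ Finset.univ, ‖amp v p‖ :=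
    Finset.sum_nonneg fun _ _ => norm_nonneg _
  have hu' := (sum_norm_amp_le s u).trans hu
  have hv' := (sum_norm_amp_le s v).trans hv
  have hd := sum_norm_amp_le s (u - v)
  have hR : 0 ≤ R := (h0 u).trans hu'
  have hC := mul_nonneg (sobolevConst_nonneg (L := L)) (norm_nonneg (u - v))
  have heq : cubicForm s m u - cubicForm s m v
      = ∑ Q ∈ triples s, (m Q * (amp₃ u Q - amp₃ v Q)) • fourierLp 2 Q.mode := by
    rw [cubicForm, cubicForm, ← Finset.sum_sub_distrib]
    exact Finset.sum_congr rfl fun Q _ => by rw [← sub_smul, mul_sub]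
  have hb (Q : Triple) : ‖amp₃ u Q - amp₃ v Q‖
      ≤ ‖amp (u - v) Q.1‖ * ‖amp u Q.2.1‖ * ‖amp u Q.2.2‖
        + ‖amp v Q.1‖ * ‖amp (u - v) Q.2.1‖ * ‖amp u Q.2.2‖
        + ‖amp v Q.1‖ * ‖amp v Q.2.1‖ * ‖amp (u - v) Q.2.2‖ := by
    have : amp₃ u Q - amp₃ v Q = amp (u - v) Q.1 * amp u Q.2.1 * amp u Q.2.2
        + amp v Q.1 * amp (u - v) Q.2.1 * amp u Q.2.2
        + amp v Q.1 * amp v Q.2.1 * amp (u - v) Q.2.2 := by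
      simp only [amp₃, amp_sub]
      ring
    rw [this]
    refine norm_add₃_le.trans ?_
    simp only [norm_mul, le_refl]
  rw [heq]
  calc _ ≤ ∑ Q ∈ triples s, ‖m Q * (amp₃ u Q - amp₃ v Q)‖ := norm_sum_triples_smul_le _ _
    _ ≤ ∑ Q ∈ triples s, A * (‖amp (u - v) Q.1‖ * ‖amp u Q.2.1‖ * ‖amp u Q.2.2‖
        + ‖amp v Q.1‖ * ‖amp (u - v) Q.2.1‖ * ‖amp u Q.2.2‖
        + ‖amp v Q.1‖ * ‖amp v Q.2.1‖ * ‖amp (u - v) Q.2.2‖) := by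
        refine Finset.sum_le_sum fun Q hQ => ?_
        rw [norm_mul]
        exact mul_le_mul (hm Q hQ) (hb Q) (norm_nonneg _) hA
    _ = A * ((∑ p ∈ s ×ˢ Finset.univ, ‖amp (u - v) p‖) * (∑ p ∈ s ×ˢ Finset.univ, ‖amp u p‖)
          * (∑ p ∈ s ×ˢ Finset.univ, ‖amp u p‖)
        + (∑ p ∈ s ×ˢ Finset.univ, ‖amp v p‖) * (∑ p ∈ s ×ˢ Finset.univ, ‖amp (u - v) p‖)
          * (∑ p ∈ s ×ˢ Finset.univ, ‖amp u p‖)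
        + (∑ p ∈ s ×ˢ Finset.univ, ‖amp v p‖) * (∑ p ∈ s ×ˢ Finset.univ, ‖amp v p‖)
          * (∑ p ∈ s ×ˢ Finset.univ, ‖amp (u - v) p‖)) := by
        rw [← Finset.mul_sum, Finset.sum_add_distrib, Finset.sum_add_distrib]
        rw [sum_triples_mul s (fun p => ‖amp (u - v) p‖) (fun p => ‖amp u p‖) (fun p => ‖amp u p‖),
          sum_triples_mul s (fun p => ‖amp v p‖) (fun p => ‖amp (u - v) p‖) (fun p => ‖amp u p‖),
          sum_triples_mul s (fun p => ‖amp v p‖) (fun p => ‖amp v p‖) (fun p => ‖amp (u - v) p‖)]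
    _ ≤ A * ((sobolevConst L * ‖u - v‖) * R * R + R * (sobolevConst L * ‖u - v‖) * R
        + R * R * (sobolevConst L * ‖u - v‖)) := by
        have := h0 u
        have := h0 v
        have := h0 (u - v)
        gcongr
    _ = A * (3 * R ^ 2 * (sobolevConst L * ‖u - v‖)) := by ring

theorem cubicForm_sub (s : Finset ℤ) (m m' : Triple → ℂ) (v : ComplexL2 L) :
    cubicForm s (fun Q => m Q - m' Q) v = cubicForm s m v - cubicForm s m' v := by
  rw [cubicForm, cubicForm, cubicForm, ← Finset.sum_sub_distrib]
  exact Finset.sum_congr rfl fun Q _ => by rw [← sub_smul, sub_mul]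

theorem cubicForm_const_mul (s : Finset ℤ) (c : ℂ) (m : Triple → ℂ) (v : ComplexL2 L) :
    cubicForm s (fun Q => c * m Q) v = c • cubicForm s m v := by
  rw [cubicForm, cubicForm, Finset.smul_sum]
  exact Finset.sum_congr rfl fun Q _ => by rw [smul_smul, mul_assoc]

theorem propagator_fourierLp (t : ℝ) (l : ℤ) :
    propagator t (fourierLp 2 l)
      = Complex.exp (Complex.I * (t * japaneseSymbol L l : ℝ)) • fourierLp (T := L) 2 l := by
  refine fc_ext fun k => ?_
  rw [fc_propagator, map_smul, fc_fourierLp, smul_eq_mul]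
  split_ifs with h
  · rw [h]
    push_cast
    ring_nf
  · simp

/-- Passing to the interaction picture multiplies the symbol by the resonant phases. -/
theorem propagator_neg_cubicForm_propagator (s : Finset ℤ) (t : ℝ) (v : ComplexL2 L) :
    propagator (-t) (cubicForm s (fun _ => 1) (propagator t v))
      = cubicForm s (fun Q => Complex.exp (Complex.I * (Q.phase L * t : ℝ))) v := by
  rw [← propagatorₗᵢ_apply, cubicForm, map_sum, cubicForm]
  refine Finset.sum_congr rfl fun Q _ => ?_
  rw [map_smul, propagatorₗᵢ_apply, propagator_fourierLp, smul_smul]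
  congr 1
  simp only [amp₃, amp_propagator, Triple.phase, Triple.freqSum]
  have : Complex.exp (Complex.I * ((modeFreq L Q.1 + modeFreq L Q.2.1 + modeFreq L Q.2.2
        - japaneseSymbol L Q.mode) * t : ℝ))
      = Complex.exp (Complex.I * (modeFreq L Q.1 * t : ℝ))
        * Complex.exp (Complex.I * (modeFreq L Q.2.1 * t : ℝ))
        * Complex.exp (Complex.I * (modeFreq L Q.2.2 * t : ℝ))
        * Complex.exp (Complex.I * (-t * japaneseSymbol L Q.mode : ℝ)) := by
    simp only [← Complex.exp_add]
    push_cast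
    ring_nf
  rw [this]
  ring

/-- The truncation of the Fourier series of `u` to the wave numbers in `s`. -/
def truncate (s : Finset ℤ) (u : ComplexL2 L) : ComplexL2 L :=
  ∑ l ∈ s, fc l u • fourierLp 2 l

theorem fc_truncate (s : Finset ℤ) (u : ComplexL2 L) (k : ℤ) :
    fc k (truncate s u) = if k ∈ s then fc k u else 0 := by
  simp [truncate, fc_fourierLp]

/-- The truncated cubic form is the cube of a trigonometric polynomial `P`, the truncation of the
wave. Both the wave and `P` are bounded by `R`, so the clamp is inactive and the cubes differ
pointwise by at most `3R²` times the difference. -/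
theorem norm_clampCube_sub_cubicForm_le {R : NNReal} {s : Finset ℤ} {v : ComplexL2 L}
    (hR : sobolevConst L * ‖v‖ ≤ R) :
    ‖toComplex (clampCube R (wave v)) - cubicForm s (fun _ => 1) v‖
      ≤ 3 * (R : ℝ) ^ 2 * ‖toComplex (wave v) - truncate s (toComplex (wave v))‖ := by
  set P : C(AddCircle L, ℂ) := ∑ p ∈ s ×ˢ Finset.univ, amp v p • fourier p.1 with hP
  have hPR (x : AddCircle L) : ‖P x‖ ≤ R := by
    refine (P.norm_coe_le_norm x).trans ((norm_sum_le _ _).trans ?_)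
    simp only [norm_smul, fourier_norm, mul_one]
    exact (sum_norm_amp_le s v).trans hR
  have h1 : truncate s (toComplex (wave v)) = ContinuousMap.toLp 2 haarAddCircle ℂ P := by
    rw [hP, map_sum, Finset.sum_product]
    unfold truncate
    refine Finset.sum_congr rfl fun l _ => ?_
    simp only [Fintype.sum_bool, map_smul]
    rw [← add_smul]
    congr 1
    rw [fc_wave, fc_toComplex_realPart, ← fc_star]
    simp only [amp, if_true, Bool.false_eq_true, if_false]
    ring
  have h2 : cubicForm s (fun _ => 1) v = ContinuousMap.toLp 2 haarAddCircle ℂ (P ^ 3) := by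
    have h3 : P ^ 3 = ∑ Q ∈ triples s, amp₃ v Q • fourier Q.mode := by
      rw [pow_succ, sq, hP, ← sum_triples_mul s]
      refine Finset.sum_congr rfl fun Q _ => ?_
      ext x
      simp only [ContinuousMap.mul_apply, ContinuousMap.smul_apply, smul_eq_mul, amp₃,
        Triple.mode, fourier_add]
      ring
    rw [h3, map_sum, cubicForm]
    refine Finset.sum_congr rfl fun Q _ => ?_
    rw [map_smul, one_mul]
  rw [h1, h2]
  refine Lp.norm_le_mul_norm_of_ae_le_mul ?_
  have hco (f : C(AddCircle L, ℂ)) := ContinuousMap.coeFn_toLp (E := ℂ) (p := 2)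
    (haarAddCircle (T := L)) (𝕜 := ℂ) f
  filter_upwards [hco P, hco (P ^ 3),
    Lp.coeFn_sub (toComplex (clampCube R (wave v))) (ContinuousMap.toLp 2 haarAddCircle ℂ (P ^ 3)),
    Lp.coeFn_sub (toComplex (wave v)) (ContinuousMap.toLp 2 haarAddCircle ℂ P),
    coeFn_toComplex (wave v), coeFn_toComplex (clampCube R (wave v)), coeFn_clampCube R (wave v),
    ae_abs_wave_le_of_le hR] with x e1 e2 e3 e4 e5 e6 e7 e8
  rw [e3, e4, Pi.sub_apply, Pi.sub_apply, e1, e2, e5, e6, e7, clamp_of_abs_le e8,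
    ContinuousMap.pow_apply, Complex.ofReal_pow]
  exact norm_cube_sub_cube_le (by rwa [Complex.norm_real]) (hPR x)

end Trilinear

/-! ### Resonance functions and the discrete antiderivative of an oscillation. -/

section Oscillation

theorem japaneseSymbol_add_le {L : ℝ} (k l : ℤ) :
    japaneseSymbol L (k + l) ≤ japaneseSymbol L k + japaneseSymbol L l := by
  have hk := sq_japaneseSymbol (L := L) k
  have hl := sq_japaneseSymbol (L := L) l
  have hf : freq L (k + l) = freq L k + freq L l := by
    simp only [freq]
    push_cast
    ring
  have h1 : |freq L k| ≤ japaneseSymbol L k := Real.abs_le_sqrt (by linarith)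
  have h2 : |freq L l| ≤ japaneseSymbol L l := Real.abs_le_sqrt (by linarith)
  have hk0 := japaneseSymbol_pos (L := L) k
  have hl0 := japaneseSymbol_pos (L := L) l
  rw [japaneseSymbol, Real.sqrt_le_left (by positivity), hf]
  have h3 : freq L k * freq L l ≤ japaneseSymbol L k * japaneseSymbol L l :=
    (le_abs_self _).trans (by rw [abs_mul]; gcongr)
  nlinarith

theorem abs_modeFreq (L : ℝ) (p : ℤ × Bool) : |modeFreq L p| = japaneseSymbol L p.1 := by
  unfold modeFreq
  split_ifs
  · exact abs_of_pos (japaneseSymbol_pos _)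
  · rw [abs_neg, abs_of_pos (japaneseSymbol_pos _)]

/-- Three input frequencies contribute at most `3D`, and subadditivity of the symbol gives another
`3D` for the output frequency. -/
theorem abs_phase_le {L D : ℝ} {s : Finset ℤ} (hD : ∀ l ∈ s, japaneseSymbol L l ≤ D) {Q : Triple}
    (hQ : Q ∈ triples s) : |Q.phase L| ≤ 6 * D := by
  simp only [triples, Finset.mem_product, Finset.mem_univ, and_true] at hQ
  obtain ⟨h1, h2, h3⟩ := hQ
  have e1 := hD _ h1
  have e2 := hD _ h2
  have e3 := hD _ h3
  have e4 : japaneseSymbol L Q.mode ≤ 3 * D := by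
    have := japaneseSymbol_add_le (L := L) (Q.1.1 + Q.2.1.1) Q.2.2.1
    have := japaneseSymbol_add_le (L := L) Q.1.1 Q.2.1.1
    unfold Triple.mode
    linarith
  rw [← abs_modeFreq L Q.1] at e1
  rw [← abs_modeFreq L Q.2.1] at e2
  rw [← abs_modeFreq L Q.2.2] at e3
  have e5 := japaneseSymbol_pos (L := L) Q.mode
  rw [abs_le] at e1 e2 e3 ⊢
  unfold Triple.phase Triple.freqSum
  constructor <;> linarith [e1.1, e2.1, e3.1, e1.2, e2.2, e3.2]

/-- The integral of `exp (i θ r)` over `[0, s]`. -/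
def phaseIntegral (θ s : ℝ) : ℂ := ∫ r in (0 : ℝ)..s, Complex.exp (Complex.I * (θ * r : ℝ))

theorem continuous_phase (θ : ℝ) : Continuous fun r : ℝ => Complex.exp (Complex.I * (θ * r : ℝ)) := by
  fun_prop

theorem hasDerivAt_phaseIntegral (θ s : ℝ) :
    HasDerivAt (phaseIntegral θ) (Complex.exp (Complex.I * (θ * s : ℝ))) s :=
  intervalIntegral.integral_hasDerivAt_right ((continuous_phase θ).intervalIntegrable _ _)
    ((continuous_phase θ).stronglyMeasurableAtFilter _ _) (continuous_phase θ).continuousAt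

theorem phaseIntegral_zero (θ : ℝ) : phaseIntegral θ 0 = 0 := intervalIntegral.integral_same

theorem norm_phaseIntegral_sub_le {θ τ : ℝ} (hτ : 0 ≤ τ) :
    ‖phaseIntegral θ τ - τ‖ ≤ |θ| * τ * τ := by
  have h : phaseIntegral θ τ - τ
      = ∫ r in (0 : ℝ)..τ, (Complex.exp (Complex.I * (θ * r : ℝ)) - 1) := by
    rw [intervalIntegral.integral_sub ((continuous_phase θ).intervalIntegrable _ _)
      intervalIntegrable_const, intervalIntegral.integral_const, phaseIntegral]
    simp
  rw [h]
  have := intervalIntegral.norm_integral_le_of_norm_le_const (a := 0) (b := τ) (C := |θ| * τ)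
    (f := fun r : ℝ => Complex.exp (Complex.I * (θ * r : ℝ)) - 1) fun r hr => by
      rw [Set.uIoc_of_le hτ] at hr
      refine (norm_phase_sub_one_le _).trans ?_
      rw [abs_mul, abs_of_pos hr.1]
      gcongr
      exact hr.2
  simpa [abs_of_nonneg hτ] using this

/-- The coefficient of the discrete antiderivative of the oscillating local error. -/
def phaseQuotient (θ τ : ℝ) : ℂ :=
  (phaseIntegral θ τ - τ) / (Complex.exp (Complex.I * (θ * τ : ℝ)) - 1)

/-- Here `|e^{ix} - 1| = 2|sin (x/2)|`, and Jordan's inequality applies. It excludes resonance of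
the time step with an oscillation. -/
theorem abs_le_two_mul_norm_phase_sub_one {x : ℝ} (hx : |x| ≤ 1) :
    |x| ≤ 2 * ‖Complex.exp (Complex.I * x) - 1‖ := by
  rw [Complex.norm_exp_I_mul_ofReal_sub_one, norm_mul, Real.norm_two, Real.norm_eq_abs]
  have h := Real.mul_abs_le_abs_sin (x := x / 2) (by
    rw [abs_div, abs_two]
    have := Real.pi_gt_three
    linarith)
  rw [abs_div, abs_two] at h
  have h2 : 1 / 2 * (|x| / 2) ≤ 2 / Real.pi * (|x| / 2) := by
    gcongr ?_ * _
    rw [div_le_div_iff₀ (by norm_num) Real.pi_pos]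
    linarith [Real.pi_le_four]
  linarith

/-- If the denominator vanishes, then `|θτ| ≤ 1` forces `θτ = 0`, and the numerator vanishes too;
the value `0` of the division is then harmless. Exactly resonant triples therefore cause no error.
-/
theorem phaseQuotient_mul {θ τ : ℝ} (hτ : 0 ≤ τ) (h : |θ * τ| ≤ 1) :
    phaseQuotient θ τ * (Complex.exp (Complex.I * (θ * τ : ℝ)) - 1) = phaseIntegral θ τ - τ := by
  by_cases h0 : Complex.exp (Complex.I * (θ * τ : ℝ)) - 1 = 0
  · have h1 := abs_le_two_mul_norm_phase_sub_one h
    rw [h0, norm_zero, mul_zero] at h1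
    have h2 := norm_phaseIntegral_sub_le (θ := θ) hτ
    rw [← abs_of_nonneg hτ, ← abs_mul, abs_of_nonneg hτ, le_antisymm h1 (abs_nonneg _),
      zero_mul] at h2
    rw [h0, mul_zero, norm_le_zero_iff.mp h2]
  · exact div_mul_cancel₀ _ h0

/-- The factor `|θ|` in the numerator bound `|θ|τ²` cancels against the denominator bound `|θ|τ/2`,
hence uniformity in `θ`. -/
theorem norm_phaseQuotient_le {θ τ : ℝ} (hτ : 0 ≤ τ) (h : |θ * τ| ≤ 1) :
    ‖phaseQuotient θ τ‖ ≤ 2 * τ := by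
  rw [phaseQuotient, norm_div]
  refine div_le_of_le_mul₀ (norm_nonneg _) (by positivity) ?_
  have h1 := abs_le_two_mul_norm_phase_sub_one h
  have h2 := norm_phaseIntegral_sub_le (θ := θ) hτ
  rw [abs_mul, abs_of_nonneg hτ] at h1
  nlinarith

end Oscillation

/-! ### Error analysis of the Euler method in the interaction picture. -/

section Trajectory

/-- The coefficient `-i ε² / 6` of the cubic part of the drift. -/
def cubicCoeff (ε : ℝ) : ℂ := -(Complex.I * (ε ^ 2 / 6 : ℝ))

theorem norm_cubicCoeff (ε : ℝ) : ‖cubicCoeff ε‖ = ε ^ 2 / 6 := by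
  rw [cubicCoeff, norm_neg, norm_mul, Complex.norm_I, one_mul,
    Complex.norm_of_nonneg (by positivity)]

theorem norm_phase_symbol (ε x : ℝ) :
    ‖cubicCoeff ε * Complex.exp (Complex.I * x)‖ = ε ^ 2 / 6 := by
  rw [norm_mul, norm_cubicCoeff, norm_phase, mul_one]

theorem norm_potential_symbol_le {L τ : ℝ} {s : Finset ℤ} (hτ : 0 ≤ τ) (hs : ∀ Q ∈ triples s, |Q.phase L * τ| ≤ 1)
    (ε t : ℝ) : ∀ Q ∈ triples s, ‖cubicCoeff ε * Complex.exp (Complex.I * (Q.phase L * t : ℝ))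
    * phaseQuotient (Q.phase L) τ‖ ≤ ε ^ 2 / 6 * (2 * τ) := by
  intro Q hQ
  rw [norm_mul, norm_phase_symbol]
  gcongr
  exact norm_phaseQuotient_le hτ (hs Q hQ)

variable {L : ℝ} [Fact (0 < L)] {ε S B κ τ t : ℝ} {R : NNReal} {s : Finset ℤ}

/-- The right-hand side of the equation in the interaction picture. -/
def drift (ε t : ℝ) (v : ComplexL2 L) : ComplexL2 L :=
  Complex.I • propagator (-t) (toComplex (splitTerm ε (wave (propagator t v))))

theorem norm_I_smul_propagator (t : ℝ) (u : ComplexL2 L) :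
    ‖Complex.I • propagator t u‖ = ‖u‖ := by
  rw [norm_smul, Complex.norm_I, one_mul, norm_propagator]

theorem norm_drift_le (hε : 0 < ε) {v : ComplexL2 L} (hv : sobolevConst L * ‖v‖ ≤ R) :
    ‖drift ε t v‖ ≤ ε ^ 2 * R ^ 2 / 2 * ‖v‖ := by
  rw [drift, norm_I_smul_propagator, norm_toComplex]
  refine (norm_splitTerm_le hε (ae_abs_wave_le_of_le (by rwa [norm_propagator])) R.2).trans ?_
  refine mul_le_mul_of_nonneg_left ((norm_wave_le _).trans ?_) (by positivity)
  rw [norm_propagator]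

theorem propagator_sub (t : ℝ) (u v : ComplexL2 L) :
    propagator t (u - v) = propagator t u - propagator t v :=
  (propagatorₗᵢ t).map_sub u v

theorem norm_drift_sub_le (hε : 0 < ε) {u v : ComplexL2 L} (hu : sobolevConst L * ‖u‖ ≤ R)
    (hv : sobolevConst L * ‖v‖ ≤ R) :
    ‖drift ε t u - drift ε t v‖ ≤ ε ^ 2 * R ^ 2 / 2 * ‖u - v‖ := by
  rw [drift, drift, ← smul_sub, ← propagator_sub, norm_I_smul_propagator, ← toComplex_sub,
    norm_toComplex]
  rw [← norm_propagator t] at hu hv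
  refine (norm_splitTerm_sub_le hε (ae_abs_wave_le_of_le hu) (ae_abs_wave_le_of_le hv)).trans ?_
  refine mul_le_mul_of_nonneg_left ?_ (by positivity)
  rw [← wave_sub, ← propagator_sub]
  exact (norm_wave_le _).trans (norm_propagator _ _).le

/-- The truncated cubic part of the drift. -/
def cubicDrift (s : Finset ℤ) (ε t : ℝ) (v : ComplexL2 L) : ComplexL2 L :=
  cubicForm s (fun Q => cubicCoeff ε * Complex.exp (Complex.I * (Q.phase L * t : ℝ))) v

theorem toComplex_splitTerm (R : NNReal) (ε : ℝ) (u : RealL2 L) :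
    toComplex (splitTerm ε u)
      = toComplex (quinticTerm R ε u) - ((ε ^ 2 / 6 : ℝ) : ℂ) • toComplex (clampCube R u) := by
  have h : splitTerm ε u = quinticTerm R ε u - (ε ^ 2 / 6) • clampCube R u := by
    rw [quinticTerm, add_sub_cancel_right]
  rw [h, toComplex_sub]
  congr 1
  rw [← toComplexₗ_apply, map_smul, toComplexₗ_apply, Complex.coe_smul]
  rfl

/-- The drift is split into the truncated cubic part, which oscillates, the quintic part of size
`ε⁴`, and the effect of truncation, controlled by `κ`. -/
theorem drift_eq (R : NNReal) (s : Finset ℤ) (ε t : ℝ) (v : ComplexL2 L) :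
    drift ε t v = cubicDrift s ε t v
      + Complex.I • propagator (-t) (toComplex (quinticTerm R ε (wave (propagator t v))))
      + cubicCoeff ε • propagator (-t) (toComplex (clampCube R (wave (propagator t v)))
          - cubicForm s (fun _ => 1) (propagator t v)) := by
  rw [drift, toComplex_splitTerm R, propagator_sub, propagator_sub,
    propagator_neg_cubicForm_propagator, cubicDrift, cubicForm_const_mul, ← propagatorₗᵢ_apply,
    ← propagatorₗᵢ_apply, ← propagatorₗᵢ_apply, map_smul, smul_sub, smul_sub, smul_smul,
    cubicCoeff, neg_smul, neg_smul]
  abel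

theorem hasDerivAt_fc_cubicForm {m : ℝ → Triple → ℂ} {m' : Triple → ℂ} {r : ℝ}
    (h : ∀ Q, HasDerivAt (fun r => m r Q) (m' Q) r) (v : ComplexL2 L) (l : ℤ) :
    HasDerivAt (fun r => fc l (cubicForm s (m r) v)) (fc l (cubicForm s m' v)) r := by
  simp only [cubicForm, map_sum, map_smul, smul_eq_mul]
  exact HasDerivAt.fun_sum fun Q _ => ((h Q).mul_const _).mul_const _

/-- The oscillating part of the local error after time `r`. -/
def oscillation (s : Finset ℤ) (ε t r : ℝ) (v : ComplexL2 L) : ComplexL2 L :=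
  cubicForm s (fun Q => cubicCoeff ε * (Complex.exp (Complex.I * (Q.phase L * t : ℝ))
    * (phaseIntegral (Q.phase L) r - r))) v

theorem oscillation_zero (s : Finset ℤ) (ε t : ℝ) (v : ComplexL2 L) :
    oscillation s ε t 0 v = 0 := by
  simp [oscillation, cubicForm, phaseIntegral_zero]

/-- Differentiating `e^{iθt}(∫₀^{r-t} e^{iθq} dq - (r - t))` in `r` gives `e^{iθr} - e^{iθt}`: with
the state frozen, `oscillation` is exactly the Euler defect of the cubic drift. -/
theorem hasDerivAt_fc_oscillation (s : Finset ℤ) (ε t r : ℝ) (v : ComplexL2 L) (l : ℤ) :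
    HasDerivAt (fun r => fc l (oscillation s ε t (r - t) v))
      (fc l (cubicDrift s ε r v - cubicDrift s ε t v)) r := by
  rw [cubicDrift, cubicDrift, ← cubicForm_sub]
  refine hasDerivAt_fc_cubicForm (fun Q => ?_) v l
  have h1 := ((hasDerivAt_phaseIntegral (Q.phase L) (r - t)).comp_sub_const r t)
  have h2 : HasDerivAt (fun r : ℝ => ((r - t : ℝ) : ℂ)) 1 r := by
    simpa using ((hasDerivAt_id r).sub_const t).ofReal_comp
  refine (((h1.sub h2).const_mul (Complex.exp (Complex.I * (Q.phase L * t : ℝ)))).const_mul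
    (cubicCoeff ε)).congr_deriv ?_
  rw [mul_sub, ← Complex.exp_add, ← mul_sub]
  push_cast
  ring_nf

/-- A function in the interaction picture that solves the equation, with the bounds on which the
error analysis depends: `B` bounds the energy norm and `κ` the part of the wave outside the wave
numbers in `s`. -/
structure IsTrajectory (ε S B κ : ℝ) (R : NNReal) (s : Finset ℤ) (X : ℝ → ComplexL2 L) :
    Prop where
  deriv : ∀ l, ∀ t ∈ Set.Icc 0 S,
    HasDerivWithinAt (fun r => fc l (X r)) (fc l (drift ε t (X t))) (Set.Icc 0 S) t
  norm_le : ∀ t ∈ Set.Icc 0 S, ‖X t‖ ≤ B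
  wave_sub_le : ∀ t ∈ Set.Icc 0 S, ∀ r ∈ Set.Icc 0 S, t ≤ r →
    ‖wave (propagator r (X r)) - wave (propagator t (X t))‖ ≤ B * (r - t)
  tail : ∀ t ∈ Set.Icc 0 S, ‖toComplex (wave (propagator t (X t)))
    - truncate s (toComplex (wave (propagator t (X t))))‖ ≤ κ
  le_R : B ≤ R
  const_le_R : sobolevConst L ≤ R
  const_mul_le_R : sobolevConst L * (B + 1) ≤ R

variable {X : ℝ → ComplexL2 L}

theorem IsTrajectory.const_mul_norm_le (h : IsTrajectory ε S B κ R s X) (ht : t ∈ Set.Icc 0 S) :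
    sobolevConst L * ‖X t‖ ≤ R :=
  (mul_le_mul_of_nonneg_left ((h.norm_le t ht).trans (by linarith)) sobolevConst_nonneg).trans
    h.const_mul_le_R

theorem IsTrajectory.norm_increment_le (h : IsTrajectory ε S B κ R s X) (hε : 0 < ε) {r : ℝ}
    (ht : t ∈ Set.Icc 0 S) (hr : r ∈ Set.Icc 0 S) (htr : t ≤ r) :
    ‖X r - X t‖ ≤ ε ^ 2 * R ^ 3 * (r - t) := by
  have hsub : Set.Icc t r ⊆ Set.Icc 0 S := Set.Icc_subset_Icc ht.1 hr.2
  refine norm_sub_le_of_hasDerivWithinAt_fc htr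
    (fun l q hq => (h.deriv l q (hsub hq)).mono hsub) fun q hq => ?_
  refine (norm_drift_le hε (h.const_mul_norm_le (hsub hq))).trans ?_
  have h1 := (h.norm_le q (hsub hq)).trans h.le_R
  calc ε ^ 2 * R ^ 2 / 2 * ‖X q‖ ≤ ε ^ 2 * R ^ 2 / 2 * R := by gcongr
    _ = ε ^ 2 * R ^ 3 / 2 := by ring
    _ ≤ ε ^ 2 * R ^ 3 := half_le_self (by positivity)

/-- The change is split into the motion of the wave, which is Lipschitz in time, and the action of
`e^{-i(r-t)⟨∇⟩}` on a fixed quintic term. The latter is compared with a translation, which passes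
inside the nonlinearity and onto the wave. As the term already has size `ε⁴`, no cancellation is
needed. -/
theorem IsTrajectory.norm_quintic_sub_le (h : IsTrajectory ε S B κ R s X) (hε : 0 < ε) {r : ℝ}
    (ht : t ∈ Set.Icc 0 S) (hr : r ∈ Set.Icc 0 S) (htr : t ≤ r) :
    ‖propagator (-r) (toComplex (quinticTerm R ε (wave (propagator r (X r)))))
      - propagator (-t) (toComplex (quinticTerm R ε (wave (propagator t (X t)))))‖
      ≤ 2 * ε ^ 4 * R ^ 5 * (r - t) := by
  set W := fun q => wave (propagator q (X q)) with hW
  have hbd (q) (hq : q ∈ Set.Icc 0 S) : ∀ᵐ x ∂haarAddCircle, |W q x| ≤ R :=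
    ae_abs_wave_le_of_le (by rw [norm_propagator]; exact h.const_mul_norm_le hq)
  have hXt := (h.norm_le t ht).trans h.le_R
  have hWt : ‖W t‖ ≤ R := (norm_wave_le _).trans (by rwa [norm_propagator])
  have hrt : 0 ≤ r - t := sub_nonneg.mpr htr
  have e1 : propagator (-r) (toComplex (quinticTerm R ε (W r)))
      - propagator (-t) (toComplex (quinticTerm R ε (W t)))
      = propagator (-r) (toComplex (quinticTerm R ε (W r) - quinticTerm R ε (W t)))
        + propagator (-t) (propagator (-(r - t)) (toComplex (quinticTerm R ε (W t)))
            - toComplex (quinticTerm R ε (W t))) := by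
    rw [toComplex_sub, propagator_sub, propagator_sub, propagator_propagator]
    rw [show -t + -(r - t) = -r by ring]
    abel
  have e2 : ‖quinticTerm R ε (W r) - quinticTerm R ε (W t)‖
      ≤ ε ^ 4 * R ^ 4 / 2 * (R * (r - t)) := by
    refine (norm_quinticTerm_sub_le hε (hbd r hr) (hbd t ht)).trans ?_
    refine mul_le_mul_of_nonneg_left ((h.wave_sub_le t ht r hr htr).trans ?_) (by positivity)
    exact mul_le_mul_of_nonneg_right h.le_R hrt
  have e3 : ‖quinticTerm R ε (W t)‖ ≤ ε ^ 4 * R ^ 4 / 2 * R :=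
    (norm_quinticTerm_le hε (hbd t ht)).trans (by gcongr)
  have e4 : ‖translate (r - t) (quinticTerm R ε (W t)) - quinticTerm R ε (W t)‖
      ≤ ε ^ 4 * R ^ 4 / 2 * ((r - t) * R) := by
    rw [translate_quinticTerm]
    have hb : ∀ᵐ x ∂haarAddCircle, |translate (r - t) (W t) x| ≤ R := by
      filter_upwards [coeFn_translate (r - t) (W t), ae_translate (r - t) (hbd t ht)] with x h1 h2
      rwa [h1]
    refine (norm_quinticTerm_sub_le hε hb (hbd t ht)).trans ?_
    refine mul_le_mul_of_nonneg_left ((norm_translate_sub_le _ _).trans ?_) (by positivity)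
    rw [abs_of_nonneg hrt, norm_propagator]
    gcongr
  have e5 := norm_propagator_sub_self_le (quinticTerm R ε (W t)) (r - t)
  rw [abs_of_nonneg hrt] at e5
  rw [e1]
  calc _ ≤ ‖quinticTerm R ε (W r) - quinticTerm R ε (W t)‖
        + ((r - t) * ‖quinticTerm R ε (W t)‖
          + ‖translate (r - t) (quinticTerm R ε (W t)) - quinticTerm R ε (W t)‖) := by
        refine (norm_add_le _ _).trans ?_
        rw [norm_propagator, norm_propagator, norm_toComplex]
        gcongr
    _ ≤ ε ^ 4 * R ^ 4 / 2 * (R * (r - t)) + ((r - t) * (ε ^ 4 * R ^ 4 / 2 * R)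
        + ε ^ 4 * R ^ 4 / 2 * ((r - t) * R)) := by gcongr
    _ = 3 / 2 * (ε ^ 4 * R ^ 5 * (r - t)) := by ring
    _ ≤ 2 * (ε ^ 4 * R ^ 5 * (r - t)) := by gcongr; norm_num
    _ = 2 * ε ^ 4 * R ^ 5 * (r - t) := by ring

/-- The local error is the sum of an oscillating term and a remainder of higher order. -/
theorem IsTrajectory.norm_localError_sub_oscillation_le (h : IsTrajectory ε S B κ R s X)
    (hε : 0 < ε) (ht : 0 ≤ t) (hτ : 0 ≤ τ) (htS : t + τ ≤ S) :
    ‖X (t + τ) - X t - (τ : ℂ) • drift ε t (X t) - oscillation s ε t τ (X t)‖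
      ≤ τ * (ε ^ 4 * (R ^ 6 + 2 * R ^ 5) * τ + ε ^ 2 * R ^ 2 * κ) := by
  have hsub : Set.Icc t (t + τ) ⊆ Set.Icc 0 S := Set.Icc_subset_Icc ht htS
  have htm : t ∈ Set.Icc 0 S := hsub ⟨le_rfl, by linarith⟩
  have hderiv (l : ℤ) (r : ℝ) (hr : r ∈ Set.Icc t (t + τ)) :
      HasDerivWithinAt (fun r => fc l (X r - ((r - t : ℝ) : ℂ) • drift ε t (X t)
          - oscillation s ε t (r - t) (X t)))
        (fc l (drift ε r (X r) - drift ε t (X t)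
          - (cubicDrift s ε r (X t) - cubicDrift s ε t (X t)))) (Set.Icc t (t + τ)) r := by
    have h1 := (h.deriv l r (hsub hr)).mono hsub
    have h2 : HasDerivAt (fun r : ℝ => ((r - t : ℝ) : ℂ)) 1 r := by
      simpa using ((hasDerivAt_id r).sub_const t).ofReal_comp
    have h3 := (h2.mul_const (fc l (drift ε t (X t)))).hasDerivWithinAt (s := Set.Icc t (t + τ))
    have h4 := (hasDerivAt_fc_oscillation s ε t r (X t) l).hasDerivWithinAt
      (s := Set.Icc t (t + τ))
    rw [map_sub, map_sub]
    simpa only [map_sub, map_smul, smul_eq_mul, one_mul] using (h1.fun_sub h3).fun_sub h4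
  have hcube (q : ℝ) (hq : q ∈ Set.Icc 0 S) :
      ‖cubicCoeff ε • propagator (-q) (toComplex (clampCube R (wave (propagator q (X q))))
          - cubicForm s (fun _ => 1) (propagator q (X q)))‖ ≤ ε ^ 2 * R ^ 2 * κ / 2 := by
    have h1 := norm_clampCube_sub_cubicForm_le (R := R) (s := s) (v := propagator q (X q))
      (by rw [norm_propagator]; exact h.const_mul_norm_le hq)
    rw [norm_smul, norm_cubicCoeff, norm_propagator]
    calc _ ≤ ε ^ 2 / 6 * (3 * R ^ 2 * κ) := by
          refine mul_le_mul_of_nonneg_left (h1.trans ?_) (by positivity)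
          exact mul_le_mul_of_nonneg_left (h.tail q hq) (by positivity)
      _ = ε ^ 2 * R ^ 2 * κ / 2 := by ring
  have hbound (r : ℝ) (hr : r ∈ Set.Icc t (t + τ)) :
      ‖drift ε r (X r) - drift ε t (X t) - (cubicDrift s ε r (X t) - cubicDrift s ε t (X t))‖
        ≤ ε ^ 4 * (R ^ 6 + 2 * R ^ 5) * τ + ε ^ 2 * R ^ 2 * κ := by
    have hrm := hsub hr
    have hrτ : r - t ≤ τ := by linarith [hr.2]
    have a1 : ‖cubicDrift s ε r (X r) - cubicDrift s ε r (X t)‖ ≤ ε ^ 4 * R ^ 6 * τ := by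
      refine (norm_cubicForm_sub_le (A := ε ^ 2 / 6) (by positivity)
        (fun Q _ => (norm_phase_symbol _ _).le) (h.const_mul_norm_le hrm)
        (h.const_mul_norm_le htm)).trans ?_
      have hx : ‖X r - X t‖ ≤ ε ^ 2 * R ^ 3 * τ :=
        (h.norm_increment_le hε htm hrm hr.1).trans (by gcongr)
      calc ε ^ 2 / 6 * (3 * R ^ 2 * (sobolevConst L * ‖X r - X t‖))
          ≤ ε ^ 2 / 6 * (3 * R ^ 2 * (R * (ε ^ 2 * R ^ 3 * τ))) := by
            have := h.const_le_R
            gcongr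
        _ = ε ^ 4 * R ^ 6 * τ / 2 := by ring
        _ ≤ ε ^ 4 * R ^ 6 * τ := half_le_self (by positivity)
    have a2 : ‖Complex.I • propagator (-r) (toComplex (quinticTerm R ε (wave (propagator r (X r)))))
        - Complex.I • propagator (-t) (toComplex (quinticTerm R ε (wave (propagator t (X t)))))‖
        ≤ 2 * ε ^ 4 * R ^ 5 * τ := by
      rw [← smul_sub, norm_smul, Complex.norm_I, one_mul]
      exact (h.norm_quintic_sub_le hε htm hrm hr.1).trans (by gcongr)
    have a3 := hcube r hrm
    have a4 := hcube t htm
    rw [drift_eq R s ε r, drift_eq R s ε t]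
    set Ar := cubicDrift s ε r (X r)
    set Art := cubicDrift s ε r (X t)
    set At := cubicDrift s ε t (X t)
    set q1 := Complex.I • propagator (-r) (toComplex (quinticTerm R ε (wave (propagator r (X r)))))
    set q2 := Complex.I • propagator (-t) (toComplex (quinticTerm R ε (wave (propagator t (X t)))))
    generalize cubicCoeff ε • propagator (-r) (toComplex (clampCube R (wave (propagator r (X r))))
          - cubicForm s (fun _ => 1) (propagator r (X r))) = c1 at a3 ⊢
    generalize cubicCoeff ε • propagator (-t) (toComplex (clampCube R (wave (propagator t (X t))))
          - cubicForm s (fun _ => 1) (propagator t (X t))) = c2 at a4 ⊢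
    -- After subtracting the frozen cubic drift, its only surviving contribution is the change of
    -- state from `X t` to `X r`, one more factor `ε²`.
    have e : Ar + q1 + c1 - (At + q2 + c2) - (Art - At) = (Ar - Art) + (q1 - q2) + (c1 - c2) := by
      abel
    rw [e]
    calc _ ≤ ‖Ar - Art‖ + ‖q1 - q2‖ + (‖c1‖ + ‖c2‖) :=
          norm_add₃_le.trans (by gcongr; exact norm_sub_le _ _)
      _ ≤ ε ^ 4 * R ^ 6 * τ + 2 * ε ^ 4 * R ^ 5 * τ
          + (ε ^ 2 * R ^ 2 * κ / 2 + ε ^ 2 * R ^ 2 * κ / 2) := by gcongr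
      _ = ε ^ 4 * (R ^ 6 + 2 * R ^ 5) * τ + ε ^ 2 * R ^ 2 * κ := by ring
  have := norm_sub_le_of_hasDerivWithinAt_fc (by linarith) hderiv hbound
  simp only [sub_self, add_sub_cancel_left, Complex.ofReal_zero, zero_smul, sub_zero,
    oscillation_zero] at this
  rw [mul_comm τ]
  refine le_trans (le_of_eq ?_) this
  congr 1
  abel

/-- The discrete antiderivative of the oscillating term. -/
def potential (s : Finset ℤ) (ε τ t : ℝ) (v : ComplexL2 L) : ComplexL2 L :=
  cubicForm s (fun Q => cubicCoeff ε * Complex.exp (Complex.I * (Q.phase L * t : ℝ))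
    * phaseQuotient (Q.phase L) τ) v

/-- Advancing `t` by `τ` multiplies each phase by `e^{iθτ}`, and `phaseQuotient` solves `q(e^{iθτ} -
1) = ∫₀^τ e^{iθr} dr - τ`. -/
theorem potential_sub (hτ : 0 ≤ τ) (hs : ∀ Q ∈ triples s, |Q.phase L * τ| ≤ 1) (ε t : ℝ)
    (v : ComplexL2 L) :
    potential s ε τ (t + τ) v - potential s ε τ t v = oscillation s ε t τ v := by
  rw [potential, potential, ← cubicForm_sub, oscillation, cubicForm, cubicForm]
  refine Finset.sum_congr rfl fun Q hQ => ?_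
  congr 2
  rw [← phaseQuotient_mul hτ (hs Q hQ)]
  have : Complex.exp (Complex.I * (Q.phase L * (t + τ) : ℝ))
      = Complex.exp (Complex.I * (Q.phase L * t : ℝ))
        * Complex.exp (Complex.I * (Q.phase L * τ : ℝ)) := by
    rw [← Complex.exp_add]
    push_cast
    ring_nf
  rw [this]
  ring

/-- The accumulated local errors. -/
theorem IsTrajectory.norm_sum_localError_le (h : IsTrajectory ε S B κ R s X) (hε : 0 < ε)
    (hτ : 0 ≤ τ) (hs : ∀ Q ∈ triples s, |Q.phase L * τ| ≤ 1) {n : ℕ}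
    (hn : n * τ ≤ S) :
    ‖∑ k ∈ Finset.range n, (X ((k + 1 : ℕ) * τ) - X (k * τ)
        - (τ : ℂ) • drift ε (k * τ) (X (k * τ)))‖
      ≤ ε ^ 2 * τ * R ^ 3
        + n * (τ * (ε ^ 4 * (2 * R ^ 6 + 2 * R ^ 5) * τ + ε ^ 2 * R ^ 2 * κ)) := by
  set H : ℝ → ComplexL2 L := fun t => potential s ε τ t (X t) with hH
  have hmem (k : ℕ) (hk : k ≤ n) : (k : ℝ) * τ ∈ Set.Icc 0 S :=
    ⟨by positivity, le_trans (by gcongr) hn⟩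
  have hbd (t : ℝ) (ht : t ∈ Set.Icc 0 S) : ‖H t‖ ≤ ε ^ 2 * τ * R ^ 3 / 3 := by
    refine (norm_cubicForm_le (A := ε ^ 2 / 6 * (2 * τ)) (by positivity)
      (norm_potential_symbol_le hτ hs ε t) (X t)).trans ?_
    calc _ ≤ ε ^ 2 / 6 * (2 * τ) * (R : ℝ) ^ 3 := by
          have := mul_nonneg (sobolevConst_nonneg (L := L)) (norm_nonneg (X t))
          gcongr
          exact h.const_mul_norm_le ht
      _ = ε ^ 2 * τ * R ^ 3 / 3 := by ring
  have hstep (k : ℕ) (hk : k ∈ Finset.range n) :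
      ‖X ((k + 1 : ℕ) * τ) - X (k * τ) - (τ : ℂ) • drift ε (k * τ) (X (k * τ))
        - (H ((k + 1 : ℕ) * τ) - H (k * τ))‖
      ≤ τ * (ε ^ 4 * (2 * R ^ 6 + 2 * R ^ 5) * τ + ε ^ 2 * R ^ 2 * κ) := by
    have hk := Finset.mem_range.mp hk
    have h0 := hmem k hk.le
    have h1 := hmem (k + 1) hk
    have hk1 : ((k + 1 : ℕ) : ℝ) * τ = k * τ + τ := by push_cast; ring
    have a1 := h.norm_localError_sub_oscillation_le hε h0.1 hτ (hk1 ▸ h1.2)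
    rw [← potential_sub hτ hs] at a1
    -- The oscillation is a difference of potentials at the frozen state `X (k τ)`, whereas `H`
    -- moves with `X`. Replacing one by the other costs the `ε²τ` size of the potential times the
    -- `ε²τ` increment.
    have a2 : ‖potential s ε τ (k * τ + τ) (X (k * τ + τ)) - potential s ε τ (k * τ + τ) (X (k * τ))‖
        ≤ τ * (ε ^ 4 * R ^ 6 * τ) := by
      rw [hk1] at h1
      refine (norm_cubicForm_sub_le (A := ε ^ 2 / 6 * (2 * τ)) (by positivity)
        (norm_potential_symbol_le hτ hs ε _) (h.const_mul_norm_le h1)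
        (h.const_mul_norm_le h0)).trans ?_
      have hx := h.norm_increment_le hε h0 h1 (by linarith)
      rw [add_sub_cancel_left] at hx
      calc _ ≤ ε ^ 2 / 6 * (2 * τ) * (3 * R ^ 2 * (R * (ε ^ 2 * R ^ 3 * τ))) := by
            have := h.const_le_R
            gcongr
        _ = τ * (ε ^ 4 * R ^ 6 * τ) := by ring
    rw [hk1]
    set P := potential s ε τ (k * τ + τ) (X (k * τ))
    have e : X (k * τ + τ) - X (k * τ) - (τ : ℂ) • drift ε (k * τ) (X (k * τ))
        - (H (k * τ + τ) - H (k * τ))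
        = (X (k * τ + τ) - X (k * τ) - (τ : ℂ) • drift ε (k * τ) (X (k * τ)) - (P - H (k * τ)))
          - (H (k * τ + τ) - P) := by abel
    rw [e]
    refine (norm_sub_le _ _).trans ((add_le_add a1 a2).trans (le_of_eq ?_))
    ring
  have hsum : ∑ k ∈ Finset.range n, (X ((k + 1 : ℕ) * τ) - X (k * τ)
        - (τ : ℂ) • drift ε (k * τ) (X (k * τ)))
      = (H (n * τ) - H ((0 : ℕ) * τ))
        + ∑ k ∈ Finset.range n, (X ((k + 1 : ℕ) * τ) - X (k * τ)
        - (τ : ℂ) • drift ε (k * τ) (X (k * τ)) - (H ((k + 1 : ℕ) * τ) - H (k * τ))) := by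
    -- The increments of `H` telescope, so this part contributes only two boundary terms, whatever
    -- the number of steps.
    rw [← Finset.sum_range_sub (fun k : ℕ => H (k * τ)), ← Finset.sum_add_distrib]
    exact Finset.sum_congr rfl fun k _ => by abel
  rw [hsum]
  refine (norm_add_le _ _).trans (add_le_add ?_ ?_)
  · refine (norm_sub_le _ _).trans ?_
    have h1 := hbd _ (hmem n le_rfl)
    have h2 := hbd _ (hmem 0 n.zero_le)
    have h3 : 0 ≤ ε ^ 2 * τ * (R : ℝ) ^ 3 := by positivity
    exact (add_le_add h1 h2).trans (by linarith)
  · refine (norm_sum_le_of_le _ hstep).trans (le_of_eq ?_)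
    rw [Finset.sum_const, Finset.card_range, nsmul_eq_mul]

/-- The numerical solution in the interaction picture. -/
def scheme (ε τ : ℝ) (v : ComplexL2 L) : ℕ → ComplexL2 L
  | 0 => v
  | n + 1 => scheme ε τ v n + (τ : ℂ) • drift ε (n * τ) (scheme ε τ v n)

/-- Stability: if the accumulated local errors are at most `E`, the global error is at most
`E exp (R² T / 2)`. -/
theorem IsTrajectory.norm_sub_scheme_le (h : IsTrajectory ε S B κ R s X) (hε : 0 < ε)
    (hτ : 0 ≤ τ) {T E : ℝ} (hST : ε ^ 2 * S = T) (hE : 0 ≤ E)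
    (hE1 : E * Real.exp (R ^ 2 / 2 * T) ≤ 1)
    (hsum : ∀ n : ℕ, n * τ ≤ S → ‖∑ k ∈ Finset.range n, (X ((k + 1 : ℕ) * τ) - X (k * τ)
        - (τ : ℂ) • drift ε (k * τ) (X (k * τ)))‖ ≤ E) {n : ℕ} (hn : n * τ ≤ S) :
    ‖X (n * τ) - scheme ε τ (X 0) n‖ ≤ E * Real.exp (R ^ 2 / 2 * T) := by
  set a : ℝ := τ * (ε ^ 2 * R ^ 2 / 2) with ha
  have ha0 : 0 ≤ a := by positivity
  have hexp (k : ℕ) (hk : k * τ ≤ S) : E * (1 + a) ^ k ≤ E * Real.exp (R ^ 2 / 2 * T) := by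
    refine mul_le_mul_of_nonneg_left ?_ hE
    calc (1 + a) ^ k ≤ Real.exp a ^ k := by
          gcongr
          rw [add_comm]
          exact Real.add_one_le_exp a
      _ = Real.exp (k * a) := by rw [← Real.exp_nat_mul]
      _ ≤ Real.exp (R ^ 2 / 2 * T) := by
          rw [Real.exp_le_exp, ← hST]
          calc k * a = R ^ 2 / 2 * (ε ^ 2 * (k * τ)) := by rw [ha]; ring
            _ ≤ R ^ 2 / 2 * (ε ^ 2 * S) := by gcongr
  -- The defects are kept together in one sum: bounding them step by step would destroy the
  -- cancellation.
  have herr (n : ℕ) : X (n * τ) - scheme ε τ (X 0) n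
      = ∑ k ∈ Finset.range n, (X ((k + 1 : ℕ) * τ) - X (k * τ)
          - (τ : ℂ) • drift ε (k * τ) (X (k * τ)))
        + ∑ k ∈ Finset.range n, (τ : ℂ) • (drift ε (k * τ) (X (k * τ))
          - drift ε (k * τ) (scheme ε τ (X 0) k)) := by
    induction n with
    | zero => simp [scheme]
    | succ n ih =>
      rw [Finset.sum_range_succ, Finset.sum_range_succ, scheme, smul_sub, ← sub_eq_zero]
      rw [← sub_eq_zero] at ih
      rw [← ih]
      abel
  have hmain : ∀ n : ℕ, n * τ ≤ S → ‖X (n * τ) - scheme ε τ (X 0) n‖ ≤ E * (1 + a) ^ n := by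
    intro n
    induction n using Nat.strong_induction_on with
    | _ n ih =>
      intro hn
      have hk (k : ℕ) (hk : k ∈ Finset.range n) :
          ‖(τ : ℂ) • (drift ε (k * τ) (X (k * τ)) - drift ε (k * τ) (scheme ε τ (X 0) k))‖
            ≤ a * (E * (1 + a) ^ k) := by
        have hkn := Finset.mem_range.mp hk
        have hkS : k * τ ≤ S := le_trans (by gcongr) hn
        have hmem : (k : ℝ) * τ ∈ Set.Icc 0 S := ⟨by positivity, hkS⟩
        have h1 := ih k hkn hkS
        have h2 := (h1.trans (hexp k hkS)).trans hE1
        -- Bootstrap: earlier errors are at most `1`, so the numerical solution remains in the ball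
        -- of radius `B + 1`, where the drift is Lipschitz.
        have h3 : ‖scheme ε τ (X 0) k‖ ≤ B + 1 := by
          have := norm_sub_norm_le (scheme ε τ (X 0) k) (X (k * τ))
          rw [norm_sub_rev] at this
          linarith [h.norm_le _ hmem]
        have h4 : sobolevConst L * ‖scheme ε τ (X 0) k‖ ≤ R :=
          (mul_le_mul_of_nonneg_left h3 sobolevConst_nonneg).trans h.const_mul_le_R
        rw [norm_smul, Complex.norm_of_nonneg hτ, ha, mul_assoc τ]
        refine mul_le_mul_of_nonneg_left ?_ hτ
        exact (norm_drift_sub_le hε (h.const_mul_norm_le hmem) h4).trans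
          (mul_le_mul_of_nonneg_left h1 (by positivity))
      rw [herr]
      refine (norm_add_le _ _).trans ((add_le_add (hsum n hn) (norm_sum_le_of_le _ hk)).trans ?_)
      -- Since `a ∑ (1 + a)^k = (1 + a)^n - 1`, the bound `E + E((1 + a)^n - 1)` closes the
      -- induction exactly.
      have hgeom := geom_sum_mul (1 + a) n
      rw [add_sub_cancel_left] at hgeom
      rw [← Finset.mul_sum, ← Finset.mul_sum]
      refine le_of_eq ?_
      linear_combination E * hgeom
  exact (hmain n hn).trans (hexp n hn)

end Trajectory

/-! ### From the wave equation and the Lawson scheme to the interaction picture, and the final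
bounds. -/

section Energy

variable {L : ℝ} [Fact (0 < L)] {ε S K T τ κ B : ℝ} {R : NNReal} {m : ℕ} {w z : ℝ → RealL2 L}

/-- `Ξ` is the function `⟨∇⟩ u - i v`. -/
def IsEnergyVariable (u v : RealL2 L) (Ξ : ComplexL2 L) : Prop :=
  ∀ l, fc l Ξ = japaneseSymbol L l * fc l (toComplex u) - Complex.I * fc l (toComplex v)

theorem exists_isEnergyVariable (hS : 0 < S) (h : IsSolution ε S w z)
    (hr : RegularityBound m K S w z) {t : ℝ} (ht : t ∈ Set.Icc 0 S) :
    ∃ Ξ : ComplexL2 L, IsEnergyVariable (w t) (z t) Ξ ∧ ‖Ξ‖ ≤ 2 * max K 0 := by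
  have hK : 0 ≤ max K 0 := le_max_right _ _
  have hone (l : ℤ) : 1 ≤ 1 + freq L l ^ 2 := by nlinarith [sq_nonneg (freq L l)]
  have hb (r : Finset ℤ) : ∑ l ∈ r, ‖(japaneseSymbol L l : ℂ) * fc l (toComplex (w t))
      - Complex.I * fc l (toComplex (z t))‖ ^ 2 ≤ (2 * max K 0) ^ 2 := by
    obtain ⟨h1, h2⟩ := hr.sum_le hS h ht r
    calc _ ≤ ∑ l ∈ r, (2 * ((1 + freq L l ^ 2) ^ (m + 1) * ‖fc l (toComplex (w t))‖ ^ 2)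
          + 2 * ((1 + freq L l ^ 2) ^ m * ‖fc l (toComplex (z t))‖ ^ 2)) := by
          refine Finset.sum_le_sum fun l _ => ?_
          have a1 := norm_sub_le ((japaneseSymbol L l : ℂ) * fc l (toComplex (w t)))
            (Complex.I * fc l (toComplex (z t)))
          rw [norm_mul, norm_mul, Complex.norm_I, one_mul,
            Complex.norm_of_nonneg (japaneseSymbol_pos l).le] at a1
          have a2 : (japaneseSymbol L l * ‖fc l (toComplex (w t))‖) ^ 2
              ≤ (1 + freq L l ^ 2) ^ (m + 1) * ‖fc l (toComplex (w t))‖ ^ 2 := by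
            rw [mul_pow, sq_japaneseSymbol]
            gcongr
            exact le_self_pow₀ (hone l) m.succ_ne_zero
          have a3 : ‖fc l (toComplex (z t))‖ ^ 2
              ≤ (1 + freq L l ^ 2) ^ m * ‖fc l (toComplex (z t))‖ ^ 2 :=
            le_mul_of_one_le_left (by positivity) (one_le_pow₀ (hone l))
          calc _ ≤ (japaneseSymbol L l * ‖fc l (toComplex (w t))‖
                + ‖fc l (toComplex (z t))‖) ^ 2 := by gcongr
            _ ≤ 2 * ((japaneseSymbol L l * ‖fc l (toComplex (w t))‖) ^ 2
                + ‖fc l (toComplex (z t))‖ ^ 2) := add_sq_le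
            _ ≤ _ := by linarith
      _ ≤ 2 * (max K 0) ^ 2 + 2 * (max K 0) ^ 2 := by
          rw [Finset.sum_add_distrib, ← Finset.mul_sum, ← Finset.mul_sum]
          gcongr
      _ = (2 * max K 0) ^ 2 := by ring
  obtain ⟨Ξ, hΞ⟩ := exists_fc_eq (L := L) hb
  refine ⟨Ξ, hΞ, norm_le_of_sum_sq_fc_le (by positivity) fun r => ?_⟩
  simpa only [hΞ] using hb r

/-- Because `w` and `∂ₜw` are real, reflection and conjugation change only the sign of the second
term; hence `Ξ` determines both functions. -/
theorem IsEnergyVariable.star_fc_neg {u v : RealL2 L} {Ξ : ComplexL2 L}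
    (h : IsEnergyVariable u v Ξ) (l : ℤ) :
    star (fc (-l) Ξ)
      = japaneseSymbol L l * fc l (toComplex u) + Complex.I * fc l (toComplex v) := by
  rw [h, japaneseSymbol_neg, fc_toComplex_neg, fc_toComplex_neg]
  simp only [RCLike.star_def, map_sub, map_mul, Complex.conj_ofReal, Complex.conj_I,
    Complex.conj_conj]
  ring

theorem toComplex_injective : Function.Injective (toComplex (L := L)) :=
  Function.LeftInverse.injective realPart_toComplex

theorem IsEnergyVariable.wave_eq {u v : RealL2 L} {Ξ : ComplexL2 L}
    (h : IsEnergyVariable u v Ξ) : wave Ξ = u := by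
  refine toComplex_injective (fc_ext fun l => ?_)
  rw [fc_wave, fc_toComplex_realPart, h.star_fc_neg, h]
  field_simp [japaneseSymbol_ne_zero (L := L) l]
  ring

theorem IsEnergyVariable.initialPsi_eq {u v : RealL2 L} {Ξ : ComplexL2 L}
    (h : IsEnergyVariable u v Ξ) : initialPsi u v = japaneseInv Ξ := by
  refine fc_ext fun l => ?_
  rw [initialPsi, map_sub, map_smul, fc_japaneseInv, fc_japaneseInv, h, smul_eq_mul, mul_sub,
    inv_mul_cancel_left₀ (japaneseSymbol_ne_zero l)]
  ring

/-- Lawson's method is Euler's method for `X`: the inverse propagator in the drift cancels the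
accumulated `e^{inτ⟨∇⟩}` and leaves the single factor `e^{iτ⟨∇⟩}` of one step. -/
theorem lawsonPsi_eq {φ γ : RealL2 L} {Ξ : ComplexL2 L} (h : IsEnergyVariable φ γ Ξ)
    (ε τ : ℝ) (n : ℕ) :
    lawsonPsi ε τ φ γ n = japaneseInv (propagator (n * τ) (scheme ε τ Ξ n)) := by
  induction n with
  | zero => rw [lawsonPsi, h.initialPsi_eq, scheme, Nat.cast_zero, zero_mul, propagator_zero]
  | succ n ih =>
    have h1 : ((n + 1 : ℕ) : ℝ) * τ = τ + n * τ := by push_cast; ring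
    rw [lawsonPsi, lawsonStep, ih, nlsTerm, scheme, h1, ← propagator_propagator,
      ← propagatorₗᵢ_apply (n * τ) (_ + _), map_add, map_smul, drift, map_smul,
      propagatorₗᵢ_apply, propagatorₗᵢ_apply, propagator_propagator, add_neg_cancel,
      propagator_zero]
    refine fc_ext fun l => ?_
    simp only [map_add, map_smul, fc_propagator, fc_japaneseInv, smul_eq_mul, wave]
    ring

/-- The two error components are the half sum and half difference of `Ξ - Θ` and its conjugate, so
each has norm at most that of `Ξ - Θ`. -/
theorem lawsonError_le {Ξ : ComplexL2 L} {n : ℕ} {Ξ₀ : ComplexL2 L}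
    (h : IsEnergyVariable (w (n * τ)) (z (n * τ)) Ξ) (h₀ : IsEnergyVariable (w 0) (z 0) Ξ₀) :
    lawsonError ε τ w z n
      ≤ ENNReal.ofReal (2 * ‖Ξ - propagator (n * τ) (scheme ε τ Ξ₀ n)‖) := by
  set Θ := propagator (n * τ) (scheme ε τ Ξ₀ n) with hΘ
  have hstar (u v : ComplexL2 L) (c : ℂ) (hc : ‖c‖ = 1 / 2) (hs : ‖v‖ = ‖u‖) :
      ‖c • (u + v)‖ ≤ ‖u‖ := by
    rw [norm_smul, hc]
    have := norm_add_le u v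
    linarith
  have h1 : sobolevNorm 1 (toComplex (w (n * τ)) - lawsonW ε τ (w 0) (z 0) n)
      = ENNReal.ofReal ‖(1 / 2 : ℂ) • ((Ξ - Θ) + star (Ξ - Θ))‖ := by
    refine sobolevNorm_eq_of_fc fun l => ?_
    rw [lawsonW, lawsonPsi_eq h₀, ← hΘ, ← h.wave_eq, ← toComplex_realPart, ← toComplex_realPart,
      pow_one, ← sq_japaneseSymbol, ← mul_pow, ← Complex.norm_of_nonneg (japaneseSymbol_pos l).le,
      ← norm_mul]
    have : realPart (japaneseInv Θ) = wave Θ := rfl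
    rw [this, map_sub, fc_wave, fc_wave, realPart_sub, toComplex_sub, map_sub, mul_sub,
      mul_inv_cancel_left₀ (japaneseSymbol_ne_zero l),
      mul_inv_cancel_left₀ (japaneseSymbol_ne_zero l)]
  have h2 : sobolevNorm 0 (toComplex (z (n * τ)) - lawsonZ ε τ (w 0) (z 0) n)
      = ENNReal.ofReal ‖(Complex.I / 2) • ((Ξ - Θ) + -star (Ξ - Θ))‖ := by
    refine sobolevNorm_eq_of_fc fun l => ?_
    have hj : japanese (japaneseInv Θ - star (japaneseInv Θ)) = Θ - star Θ := by
      refine fourierMultiplier_eq_of_fc fun l => ?_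
      rw [map_sub, map_sub, fc_star, fc_star, fc_japaneseInv, fc_japaneseInv, japaneseSymbol_neg,
        star_mul', star_inv₀, RCLike.star_def, Complex.conj_ofReal, mul_sub,
        mul_inv_cancel_left₀ (japaneseSymbol_ne_zero l),
        mul_inv_cancel_left₀ (japaneseSymbol_ne_zero l)]
    have hz : fc l (toComplex (z (n * τ))) = Complex.I / 2 * (fc l Ξ - star (fc (-l) Ξ)) := by
      rw [h.star_fc_neg, h]
      linear_combination (fc l (toComplex (z (n * τ)))) * Complex.I_sq
    rw [lawsonZ, lawsonPsi_eq h₀, ← hΘ, hj, pow_zero, one_mul]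
    congr 2
    simp only [map_sub, map_add, map_neg, map_smul, smul_eq_mul, fc_star, star_sub, hz]
    ring
  rw [lawsonError, h1, h2, ← ENNReal.ofReal_add (norm_nonneg _) (norm_nonneg _)]
  refine ENNReal.ofReal_le_ofReal ?_
  have a1 := hstar (Ξ - Θ) (star (Ξ - Θ)) (1 / 2) (by norm_num) (norm_star_eq _)
  have a2 := hstar (Ξ - Θ) (-star (Ξ - Θ)) (Complex.I / 2) (by norm_num)
    (by rw [norm_neg, norm_star_eq])
  linarith

/-- Every omitted mode has symbol at least `D`, so `m + 1` derivatives buy the factor `D^{-(m+1)}`.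
-/
theorem norm_sub_truncate_le {s : Finset ℤ} {u : ComplexL2 L} {D : ℝ} (hD : 0 < D) (hK : 0 ≤ K)
    (hs : ∀ l, l ∉ s → D ≤ japaneseSymbol L l)
    (hu : ∀ r : Finset ℤ, ∑ l ∈ r, (1 + freq L l ^ 2) ^ (m + 1) * ‖fc l u‖ ^ 2 ≤ K ^ 2) :
    ‖u - truncate s u‖ ≤ K * D⁻¹ ^ (m + 1) := by
  refine norm_le_of_sum_sq_fc_le (by positivity) fun r => ?_
  calc ∑ l ∈ r, ‖fc l (u - truncate s u)‖ ^ 2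
      ≤ ∑ l ∈ r, (D⁻¹ ^ (m + 1)) ^ 2 * ((1 + freq L l ^ 2) ^ (m + 1) * ‖fc l u‖ ^ 2) := by
        refine Finset.sum_le_sum fun l _ => ?_
        rw [map_sub, fc_truncate]
        split_ifs with hl
        · rw [sub_self, norm_zero, zero_pow two_ne_zero]
          positivity
        · rw [sub_zero, ← mul_assoc]
          refine le_mul_of_one_le_left (by positivity) ?_
          rw [← sq_japaneseSymbol, ← pow_mul, ← pow_mul, mul_comm (m + 1) 2, ← mul_pow]
          refine one_le_pow₀ ?_
          rw [inv_mul_eq_div, one_le_div hD]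
          exact hs l hl
    _ ≤ (D⁻¹ ^ (m + 1)) ^ 2 * K ^ 2 := by
        rw [← Finset.mul_sum]
        gcongr
        exact hu r
    _ = (K * D⁻¹ ^ (m + 1)) ^ 2 := by ring

theorem isTrajectory_of_isSolution (hS : 0 < S) (h : IsSolution ε S w z)
    (hr : RegularityBound m K S w z) {Ξ : ℝ → ComplexL2 L}
    (hΞ : ∀ t ∈ Set.Icc 0 S, IsEnergyVariable (w t) (z t) (Ξ t) ∧ ‖Ξ t‖ ≤ 2 * max K 0)
    {s : Finset ℤ} {D : ℝ} (hD : 0 < D) (hs : ∀ l, l ∉ s → D ≤ japaneseSymbol L l)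
    (hR1 : 2 * max K 0 ≤ R) (hR2 : sobolevConst L ≤ R)
    (hR3 : sobolevConst L * (2 * max K 0 + 1) ≤ R) :
    IsTrajectory ε S (2 * max K 0) (max K 0 * D⁻¹ ^ (m + 1)) R s
      (fun t => propagator (-t) (Ξ t)) := by
  have hK : 0 ≤ max K 0 := le_max_right _ _
  have hback (t : ℝ) : propagator t (propagator (-t) (Ξ t)) = Ξ t := by
    rw [propagator_propagator, add_neg_cancel, propagator_zero]
  have hw (t) (ht : t ∈ Set.Icc 0 S) : wave (propagator t (propagator (-t) (Ξ t))) = w t := by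
    rw [hback, (hΞ t ht).1.wave_eq]
  have hz (t) (ht : t ∈ Set.Icc 0 S) : ‖toComplex (z t)‖ ≤ max K 0 := by
    refine norm_le_of_sum_sq_fc_le hK fun r => le_trans ?_ (hr.sum_le hS h ht r).2
    refine Finset.sum_le_sum fun l _ => le_mul_of_one_le_left (by positivity) (one_le_pow₀ ?_)
    nlinarith [sq_nonneg (freq L l)]
  refine ⟨fun l t ht => ?_, fun t ht => ?_, fun t ht r hr' htr => ?_, fun t ht => ?_, hR1, hR2, hR3⟩
  · have h1 := h.hasDerivWithinAt_fc_w l ht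
    have h2 := h.hasDerivWithinAt_fc_z l ht
    set δ : ℂ := (japaneseSymbol L l : ℂ) with hδ
    have h3 : HasDerivAt (fun r : ℝ => Complex.exp (-(Complex.I * r * δ)))
        (Complex.exp (-(Complex.I * t * δ)) * (-(Complex.I * δ))) t := by
      refine HasDerivAt.cexp ?_
      have h4 : HasDerivAt (fun r : ℝ => (r : ℂ)) 1 t := (hasDerivAt_id t).ofReal_comp
      simpa using ((h4.const_mul Complex.I).mul_const δ).fun_neg
    have h5 := h3.hasDerivWithinAt.fun_mul
      ((h1.const_mul δ).fun_sub (h2.const_mul Complex.I)) (s := Set.Icc 0 S)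
    have hval (r) (hr : r ∈ Set.Icc 0 S) : fc l (propagator (-r) (Ξ r))
        = Complex.exp (-(Complex.I * r * δ))
          * (δ * fc l (toComplex (w r)) - Complex.I * fc l (toComplex (z r))) := by
      rw [fc_propagator_neg, (hΞ r hr).1]
    refine (h5.congr hval (hval t ht)).congr_deriv ?_
    rw [drift, hw t ht, map_smul, fc_propagator_neg, smul_eq_mul, ← hδ]
    -- The terms in `δ²w` and `δz` cancel between the derivative of the phase and the equations for
    -- `w` and `z`; only the nonlinearity remains.
    linear_combination (Complex.exp (-(Complex.I * t * δ)) * δ * fc l (toComplex (z t)))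
      * Complex.I_sq
  · rw [norm_propagator]
    exact (hΞ t ht).2
  · rw [hw t ht, hw r hr', ← norm_toComplex, toComplex_sub]
    have hsub : Set.Icc t r ⊆ Set.Icc 0 S := Set.Icc_subset_Icc ht.1 hr'.2
    exact norm_sub_le_of_hasDerivWithinAt_fc (y := fun t => toComplex (w t)) htr
      (fun l q hq => (h.hasDerivWithinAt_fc_w l (hsub hq)).mono hsub)
      (fun q hq => (hz q (hsub hq)).trans (by linarith))
  · rw [hw t ht]
    exact norm_sub_truncate_le hD hK hs fun r => (hr.sum_le hS h ht r).1

theorem finite_japaneseSymbol_lt (D : ℝ) : {l : ℤ | japaneseSymbol L l < D}.Finite := by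
  have hL : 0 < L := Fact.out
  rcases le_or_gt D 0 with hD | hD
  · convert Set.finite_empty
    exact Set.eq_empty_of_forall_notMem fun l hl => (japaneseSymbol_pos l).not_ge (hl.le.trans hD)
  · have h := (summable_inv_sq_japaneseSymbol hL).tendsto_cofinite_zero.eventually_lt_const
      (u := D⁻¹ ^ 2) (by positivity)
    refine Set.Finite.subset (Filter.eventually_cofinite.mp h) fun l (hl : _ < D) => ?_
    have := japaneseSymbol_pos (L := L) l
    simp only [Set.mem_ofPred_eq, not_lt]
    gcongr

/-- The error bound in terms of the frequency cutoff `D` of the analysis. -/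
theorem lawsonError_le_of_cutoff (hT : 0 < T) (hε : 0 < ε) (hτ : 0 < τ) {D : ℝ} (hD : 0 < D)
    (hDτ : 6 * D * τ ≤ 1) (h : IsSolution ε (T / ε ^ 2) w z)
    (hr : RegularityBound m K (T / ε ^ 2) w z) (hR1 : 2 * max K 0 ≤ R) (hR2 : sobolevConst L ≤ R)
    (hR3 : sobolevConst L * (2 * max K 0 + 1) ≤ R) {E : ℝ}
    (hE : ε ^ 2 * τ * R ^ 3 + T * (ε ^ 2 * (2 * R ^ 6 + 2 * R ^ 5) * τ
      + R ^ 2 * (max K 0 * D⁻¹ ^ (m + 1))) ≤ E)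
    (hE1 : E * Real.exp (R ^ 2 / 2 * T) ≤ 1) {n : ℕ} (hn : (n : ℝ) ≤ T / ε ^ 2 / τ) :
    lawsonError ε τ w z n ≤ ENNReal.ofReal (2 * (E * Real.exp (R ^ 2 / 2 * T))) := by
  set S := T / ε ^ 2 with hS
  have hS0 : 0 < S := by positivity
  have hST : ε ^ 2 * S = T := by rw [hS]; field_simp
  have hex := fun t (ht : t ∈ Set.Icc 0 S) => exists_isEnergyVariable hS0 h hr ht
  choose! Ξ hΞ using hex
  set s : Finset ℤ := (finite_japaneseSymbol_lt (L := L) D).toFinset with hs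
  have hmem (l : ℤ) : l ∈ s ↔ japaneseSymbol L l < D := by
    rw [hs, Set.Finite.mem_toFinset, Set.mem_ofPred_eq]
  have htraj := isTrajectory_of_isSolution (R := R) hS0 h hr hΞ (s := s) hD
    (fun l hl => not_lt.mp fun h => hl ((hmem l).mpr h)) hR1 hR2 hR3
  have hphase : ∀ Q ∈ triples s, |Q.phase L * τ| ≤ 1 := fun Q hQ => by
    rw [abs_mul, abs_of_pos hτ]
    have := abs_phase_le (L := L) (fun l hl => ((hmem l).mp hl).le) hQ
    exact (mul_le_mul_of_nonneg_right this hτ.le).trans hDτ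
  have hnS : n * τ ≤ S := by rwa [le_div_iff₀ hτ] at hn
  have hκ : 0 ≤ max K 0 * D⁻¹ ^ (m + 1) := mul_nonneg (le_max_right _ _) (by positivity)
  have hE0 : 0 ≤ E := le_trans (by positivity) hE
  have herr := htraj.norm_sub_scheme_le hε hτ.le hST hE0 hE1 (fun k hk => by
    refine (htraj.norm_sum_localError_le hε hτ.le hphase hk).trans (le_trans ?_ hE)
    refine add_le_add le_rfl ?_
    -- The final time `S = T/ε²` consumes one factor `ε²`: `ε⁴τ` becomes `ε²τ`, and the truncation
    -- error keeps no power of `ε`.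
    rw [← mul_assoc, ← hST]
    calc _ ≤ S * (ε ^ 4 * (2 * R ^ 6 + 2 * R ^ 5) * τ
          + ε ^ 2 * R ^ 2 * (max K 0 * D⁻¹ ^ (m + 1))) :=
          mul_le_mul_of_nonneg_right hk (by positivity)
      _ = _ := by ring) hnS
  have hn' : (n : ℝ) * τ ∈ Set.Icc 0 S := ⟨by positivity, hnS⟩
  have h0' : (0 : ℝ) ∈ Set.Icc 0 S := ⟨le_rfl, hS0.le⟩
  refine (lawsonError_le (hΞ _ hn').1 (hΞ _ h0').1).trans (ENNReal.ofReal_le_ofReal ?_)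
  refine mul_le_mul_of_nonneg_left (le_trans (le_of_eq ?_) herr) (by norm_num)
  rw [neg_zero, propagator_zero, ← norm_propagator (n * τ) (propagator (-(n * τ)) _ - _), propagator_sub,
    propagator_propagator, add_neg_cancel, propagator_zero]

/-- The uniform error bound for solutions of finite regularity. -/
theorem exists_lawsonError_le (hT : 0 < T) (m : ℕ) (K : ℝ) {β : ℝ} (hβ : 0 < β) :
    ∃ τmax : ℝ, 0 < τmax ∧ τmax ≤ 1 ∧ ∃ C : ℝ, 0 < C ∧
      ∀ τ₀ : ℝ, 0 < τ₀ → τ₀ ≤ τmax → ∀ ε : ℝ, 0 < ε → ε ≤ 1 → ∀ τ : ℝ, 0 < τ → τ < β * τ₀ →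
      ∀ w z : ℝ → RealL2 L, IsSolution ε (T / ε ^ 2) w z → RegularityBound m K (T / ε ^ 2) w z →
      ∀ n : ℕ, (n : ℝ) ≤ T / ε ^ 2 / τ →
        lawsonError ε τ w z n ≤ ENNReal.ofReal (C * (ε ^ 2 * τ + τ₀ ^ (m + 1))) := by
  have hK : 0 ≤ max K 0 := le_max_right _ _
  have hc := sobolevConst_nonneg (L := L)
  -- Large enough for the three size conditions at once: the energy bound, the embedding constant,
  -- and the embedding on a ball enlarged by `1`.
  obtain ⟨R, hR⟩ : ∃ R : NNReal,
      (R : ℝ) = 2 * max K 0 + sobolevConst L * (2 * max K 0 + 2) + 1 :=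
    ⟨⟨_, by positivity⟩, rfl⟩
  have hR0 : 0 < (R : ℝ) := by rw [hR]; positivity
  have hcK := mul_nonneg hc hK
  set A : ℝ := R ^ 3 + T * (2 * R ^ 6 + 2 * R ^ 5) + T * R ^ 2 with hA
  set G : ℝ := Real.exp (R ^ 2 / 2 * T) with hG
  set M : ℝ := max K 0 * (6 * β) ^ (m + 1) with hM
  have hA0 : 0 < A := by positivity
  have hG0 : 0 < G := Real.exp_pos _
  have hM0 : 0 ≤ M := by positivity
  -- Since `ε²τ ≤ βτ₀` and `τ₀^{m+1} ≤ τ₀`, this choice makes the total error, Gronwall factor `G`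
  -- included, at most `1`, as the bootstrap requires.
  refine ⟨min 1 (1 / (A * G * (β + M))), by positivity, min_le_left _ _, 2 * A * G * (1 + M),
    by positivity, ?_⟩
  intro τ₀ hτ₀ hmax ε hε hε1 τ hτ hττ₀ w z h hr n hn
  have hτ₀1 : τ₀ ≤ 1 := hmax.trans (min_le_left _ _)
  have hε2 : ε ^ 2 ≤ 1 := pow_le_one₀ hε.le hε1
  have hpow : τ₀ ^ (m + 1) ≤ τ₀ := pow_le_of_le_one hτ₀.le hτ₀1 m.succ_ne_zero
  -- The largest cutoff for which `6Dτ ≤ 1` holds for every `τ < βτ₀`. It depends on `τ₀` and not on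
  -- `τ`, so the tail is `M τ₀^{m+1}` even for much smaller steps.
  have hD : 0 < 1 / (6 * β * τ₀) := by positivity
  have hDτ : 6 * (1 / (6 * β * τ₀)) * τ ≤ 1 := by
    have : 6 * (1 / (6 * β * τ₀)) * τ = τ / (β * τ₀) := by field_simp
    rw [this, div_le_one (by positivity)]
    exact hττ₀.le
  have hDm : max K 0 * (1 / (6 * β * τ₀))⁻¹ ^ (m + 1) = M * τ₀ ^ (m + 1) := by
    rw [one_div, inv_inv, mul_pow, hM]
    ring
  have hE : ε ^ 2 * τ * R ^ 3 + T * (ε ^ 2 * (2 * R ^ 6 + 2 * R ^ 5) * τ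
      + R ^ 2 * (max K 0 * (1 / (6 * β * τ₀))⁻¹ ^ (m + 1)))
      ≤ A * (ε ^ 2 * τ + M * τ₀ ^ (m + 1)) := by
    rw [hDm, ← sub_nonneg]
    have : A * (ε ^ 2 * τ + M * τ₀ ^ (m + 1)) - (ε ^ 2 * τ * R ^ 3
        + T * (ε ^ 2 * (2 * R ^ 6 + 2 * R ^ 5) * τ + R ^ 2 * (M * τ₀ ^ (m + 1))))
        = T * R ^ 2 * (ε ^ 2 * τ)
          + (R ^ 3 + T * (2 * R ^ 6 + 2 * R ^ 5)) * (M * τ₀ ^ (m + 1)) := by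
      rw [hA]
      ring
    rw [this]
    positivity
  have hE1 : A * (ε ^ 2 * τ + M * τ₀ ^ (m + 1)) * G ≤ 1 := by
    calc _ ≤ A * (1 * (β * τ₀) + M * τ₀) * G := by gcongr
      _ = A * G * (β + M) * τ₀ := by ring
      _ ≤ A * G * (β + M) * (1 / (A * G * (β + M))) := by
          gcongr
          exact hmax.trans (min_le_right _ _)
      _ = 1 := mul_one_div_cancel (by positivity)
  refine (lawsonError_le_of_cutoff hT hε hτ hD hDτ h hr (by rw [hR]; linarith)
    (by rw [hR]; linarith) (by rw [hR]; linarith) hE hE1 hn).trans (ENNReal.ofReal_le_ofReal ?_)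
  have : 2 * A * G * (1 + M) * (ε ^ 2 * τ + τ₀ ^ (m + 1))
      - 2 * (A * (ε ^ 2 * τ + M * τ₀ ^ (m + 1)) * G)
      = 2 * A * G * (M * (ε ^ 2 * τ) + τ₀ ^ (m + 1)) := by ring
  rw [← sub_nonneg, this]
  positivity

end Energy

end SineGordon

end

/-! ### The two error bounds of the theorem. -/

theorem theorem3p1 (a b : ℝ) [Fact (0 < b - a)] (T : ℝ) (hT : 0 < T) :
    (∀ (m : ℕ) (K β : ℝ), 0 < β →
      ∃ τmax : ℝ, 0 < τmax ∧ τmax ≤ 1 ∧ ∃ C : ℝ, 0 < C ∧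
        ∀ τ₀ : ℝ, 0 < τ₀ → τ₀ ≤ τmax →
        ∀ ε : ℝ, 0 < ε → ε ≤ 1 →
        ∀ τ : ℝ, 0 < τ → τ < β * τ₀ →
        ∀ w z : ℝ → SineGordon.RealL2 (b - a),
          SineGordon.IsSolution ε (T / ε ^ 2) w z →
          SineGordon.RegularityBound m K (T / ε ^ 2) w z →
          ∀ n : ℕ, (n : ℝ) ≤ T / ε ^ 2 / τ →
            SineGordon.lawsonError ε τ w z n ≤
              ENNReal.ofReal (C * (ε ^ 2 * τ + τ₀ ^ (m + 1)))) ∧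
    (∀ (K : ℕ → ℝ) (N : ℕ),
      ∃ τmax : ℝ, 0 < τmax ∧ ∃ C : ℝ, 0 < C ∧
        ∀ ε : ℝ, 0 < ε → ε ≤ 1 →
        ∀ τ : ℝ, 0 < τ → τ < τmax →
        ∀ w z : ℝ → SineGordon.RealL2 (b - a),
          SineGordon.IsSolution ε (T / ε ^ 2) w z →
          (∀ m : ℕ, SineGordon.RegularityBound m (K m) (T / ε ^ 2) w z) →
          ∀ n : ℕ, (n : ℝ) ≤ T / ε ^ 2 / τ →
            SineGordon.lawsonError ε τ w z n ≤
              ENNReal.ofReal (C * (ε ^ 2 * τ + τ ^ (N + 1))) ∧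
            (τ ^ N ≤ ε ^ 2 →
              SineGordon.lawsonError ε τ w z n ≤ ENNReal.ofReal (C * (ε ^ 2 * τ)))) := by
  refine ⟨fun m K β hβ => SineGordon.exists_lawsonError_le hT m K hβ, fun K N => ?_⟩
  -- For smooth solutions take `τ₀ = τ` and `m = N`; `β = 2` secures the strict inequality `τ <
  -- βτ₀`. The constant `2C` then absorbs `τ^{N+1} ≤ ε²τ` in the last claim.
  obtain ⟨τmax, h0, -, C, hC, h⟩ :=
    SineGordon.exists_lawsonError_le (L := b - a) hT N (K N) (β := 2) two_pos
  refine ⟨τmax, h0, 2 * C, by positivity, fun ε hε hε1 τ hτ hτm w z hs hr n hn => ?_⟩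
  have key := h τ hτ hτm.le ε hε hε1 τ hτ (by linarith) w z hs (hr N) n hn
  refine ⟨key.trans (ENNReal.ofReal_le_ofReal ?_), fun hN =>
    key.trans (ENNReal.ofReal_le_ofReal ?_)⟩
  · have : 0 ≤ C * (ε ^ 2 * τ + τ ^ (N + 1)) := by positivity
    linarith
  · have : C * τ ^ (N + 1) ≤ C * (ε ^ 2 * τ) := by
      rw [pow_succ]
      gcongr
    linarith
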